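/- All spaces are based, connected and have the based homotopy type of a CW complex; all maps and homotopies preserve base points; $[X,Y]$ is the set of based homotopy classes of maps $X\to Y$, and $0\in[X,Y]$ is the class of the constant map. The only exception is that in a suspension $\Sigma A$ the based space $A$ (of the based homotopy type of a CW complex) need not itself be connected. A class $f\in[X,X]$ is called $\Sigma$-trivial if $f\circ a=0$ for every suspension $\Sigma A$ and every $a\in[\Sigma A,X]$; the set of all $\Sigma$-trivial classes in $[X,X]$ is denoted $Z_\Sigma(X)$; it is a semigroup with zero under composition. The (unreduced) Lusternik–Schnirelmann category $\mathrm{cat}(X)$ is the least $c$ such that $X$ can be covered by $c$ open subsets, each of which is contractible in $X$ (so $\mathrm{cat}(X)=1$ if $X$ is contractible). The nilpotency $t_\Sigma(X)\in\{0,1,2,\dots,\infty\}$ of $Z_\Sigma(X)$ is defined to be $0$ if $X$ is contractible; otherwise it is the least $n\ge 1$ such that every product of $n$ elements of $Z_\Sigma(X)$ is $0$ (and $\infty$ if there is no such $n$). **Proposition.** Let $X$ be a space with $\mathrm{cat}(X)<\infty$ and let $n\ge 0$ be an integer with $n\ge\log_2(\mathrm{cat}(X))$. If $f_1,\dots,f_n\in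 Z_\Sigma(X)$, then $f_1\circ\cdots\circ f_n=0$ in $[X,X]$ (for $n=0$ the composite is the identity class of $X$). Consequently $t_\Sigma(X)\le\lceil\log_2(\mathrm{cat}(X))\rceil$. -/

import Mathlib

universe u

/-- A based topological space. -/
structure BasedSpace : Type (u + 1) where
  carrier : Type u
  [top : TopologicalSpace carrier]
  pt : carrier

namespace BasedSpace

instance : CoeSort BasedSpace.{u} (Type u) := ⟨BasedSpace.carrier⟩

instance (X : BasedSpace.{u}) : TopologicalSpace X := X.top

/-- Base point preserving continuous maps. -/
@[ext]
structure Map (X Y : BasedSpace.{u}) where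
  toMap : C(X, Y)
  map_pt : toMap X.pt = Y.pt

namespace Map

/-- The identity map. -/
def id (X : BasedSpace.{u}) : Map X X := ⟨ContinuousMap.id X, rfl⟩

/-- The constant map at the base point. -/
def zero (X Y : BasedSpace.{u}) : Map X Y := ⟨ContinuousMap.const X Y.pt, rfl⟩

/-- Composition: `g.comp f` is `g ∘ f`. -/
def comp {X Y W : BasedSpace.{u}} (g : Map Y W) (f : Map X Y) : Map X W :=
  ⟨g.toMap.comp f.toMap, by simp [f.map_pt, g.map_pt]⟩

/-- Based homotopy: a homotopy that is fixed on the base point. -/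
def Homotopic {X Y : BasedSpace.{u}} (f g : Map X Y) : Prop :=
  f.toMap.HomotopicRel g.toMap {X.pt}

theorem Homotopic.comp {X Y W : BasedSpace.{u}} {g g' : Map Y W} {f f' : Map X Y}
    (hg : g.Homotopic g') (hf : f.Homotopic f') : (g.comp f).Homotopic (g'.comp f') := by
  have h1 : (g.comp f).Homotopic (g.comp f') := ContinuousMap.HomotopicRel.comp_continuousMap hf _
  refine ContinuousMap.HomotopicRel.trans h1 ?_
  obtain ⟨G⟩ := hg
  refine ⟨⟨⟨⟨fun p => G (p.1, f'.toMap p.2), by fun_prop⟩, ?_, ?_⟩, ?_⟩⟩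
  · intro x; simp [Map.comp]
  · intro x; simp [Map.comp]
  · intro t x hx
    obtain rfl : x = X.pt := hx
    have := G.eq_fst t (x := Y.pt) rfl
    simpa [Map.comp, f'.map_pt] using this

end Map

/-- Based homotopy as an equivalence relation on based maps. -/
instance mapSetoid (X Y : BasedSpace.{u}) : Setoid (Map X Y) where
  r := Map.Homotopic
  iseqv := ⟨fun f => ContinuousMap.HomotopicRel.refl f.toMap,
    fun h => ContinuousMap.HomotopicRel.symm h,
    fun h h' => ContinuousMap.HomotopicRel.trans h h'⟩

/-- The set `[X, Y]` of based homotopy classes of based maps. -/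
def HClass (X Y : BasedSpace.{u}) : Type u := Quotient (mapSetoid X Y)

namespace HClass

/-- The homotopy class of a based map. -/
def mk {X Y : BasedSpace.{u}} (f : Map X Y) : HClass X Y := Quotient.mk _ f

/-- The constant homotopy class `0 ∈ [X, Y]`. -/
instance (X Y : BasedSpace.{u}) : Zero (HClass X Y) := ⟨mk (Map.zero X Y)⟩

/-- Composition of homotopy classes: `g.comp f` is `g ∘ f`. -/
def comp {X Y W : BasedSpace.{u}} (g : HClass Y W) (f : HClass X Y) : HClass X W :=
  Quotient.map₂ Map.comp (fun _ _ hg _ _ hf => Map.Homotopic.comp hg hf) g f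

theorem comp_assoc {X Y W V : BasedSpace.{u}} (h : HClass W V) (g : HClass Y W)
    (f : HClass X Y) : (h.comp g).comp f = h.comp (g.comp f) := by
  induction h using Quotient.inductionOn
  induction g using Quotient.inductionOn
  induction f using Quotient.inductionOn
  rfl

theorem zero_comp {X Y W : BasedSpace.{u}} (f : HClass X Y) :
    (0 : HClass Y W).comp f = 0 := by
  induction f using Quotient.inductionOn
  rfl

theorem comp_zero {X Y W : BasedSpace.{u}} (g : HClass Y W) :
    g.comp (0 : HClass X Y) = 0 := by
  induction g using Quotient.inductionOn with
  | _ g =>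
    have h : g.comp (Map.zero X Y) = Map.zero X W := by
      refine Map.ext (ContinuousMap.ext fun x => ?_)
      exact g.map_pt
    exact congrArg mk h

/-- `[X, X]` is a monoid with zero: the product `g * f` is the composite `g ∘ f`, the unit is the
identity class, and `0` is the constant class. -/
instance (X : BasedSpace.{u}) : MonoidWithZero (HClass X X) where
  mul g f := g.comp f
  one := mk (Map.id X)
  zero := 0
  mul_assoc := comp_assoc
  one_mul f := by
    induction f using Quotient.inductionOn
    rfl
  mul_one f := by
    induction f using Quotient.inductionOn
    rfl
  zero_mul := zero_comp
  mul_zero := comp_zero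

end HClass

/-- `X` has the based homotopy type of a CW complex whose base point is a vertex. -/
def HasCWType (X : BasedSpace.{u}) : Prop :=
  ∃ K : BasedSpace.{u}, T2Space K ∧
    (∃ _ : Topology.CWComplex (Set.univ : Set K),
      ∃ j : Topology.RelCWComplex.cell (Set.univ : Set K) 0,
        K.pt ∈ Topology.RelCWComplex.closedCell (C := (Set.univ : Set K)) 0 j) ∧
    ∃ (f : Map X K) (g : Map K X),
      (g.comp f).Homotopic (Map.id X) ∧ (f.comp g).Homotopic (Map.id K)

/-- The equivalence relation on `A × [0,1]` collapsing `A × {0,1} ∪ {pt} × [0,1]` to a point. -/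
def suspensionSetoid (A : BasedSpace.{u}) : Setoid (A × unitInterval) where
  r p q := p = q ∨ ((p.2 = 0 ∨ p.2 = 1 ∨ p.1 = A.pt) ∧ (q.2 = 0 ∨ q.2 = 1 ∨ q.1 = A.pt))
  iseqv := ⟨fun _ => Or.inl rfl, by
    rintro p q (h | h)
    · exact Or.inl h.symm
    · exact Or.inr h.symm, by
    rintro p q r (rfl | h) (rfl | h')
    · exact Or.inl rfl
    · exact Or.inr h'
    · exact Or.inr h
    · exact Or.inr ⟨h.1, h'.2⟩⟩

/-- The (reduced) suspension `ΣA`, with the quotient topology. -/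
def suspension (A : BasedSpace.{u}) : BasedSpace.{u} where
  carrier := Quotient (suspensionSetoid A)
  pt := Quotient.mk _ (A.pt, 0)

/-- The collection `Σ` of all suspensions of spaces of the homotopy type of a CW complex. The space
`A` need not be connected (its suspension always is): for example the circle, the suspension of the
`0`-sphere, belongs to `Σ`. -/
def suspensions : Set BasedSpace.{u} := {B | ∃ A : BasedSpace.{u}, A.HasCWType ∧ B = suspension A}

/-- A class `f ∈ [X, Y]` is `F`-trivial if `f_* : [A, X] → [A, Y]` is trivial for each `A ∈ F`. -/
def IsTrivialMod (F : Set BasedSpace.{u}) {X Y : BasedSpace.{u}} (f : HClass X Y) : Prop :=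
  ∀ A ∈ F, ∀ a : HClass A X, f.comp a = 0

/-- The set `Z_F(X)` of all `F`-trivial classes in `[X, X]`. -/
def Z (F : Set BasedSpace.{u}) (X : BasedSpace.{u}) : Set (HClass X X) := {f | IsTrivialMod F f}

/-- `Z_F(X)` is a pointed semigroup under composition. -/
instance (F : Set BasedSpace.{u}) (X : BasedSpace.{u}) : SemigroupWithZero (Z F X) where
  mul g f := ⟨g.1 * f.1, fun A hA a => by
    change (g.1.comp f.1).comp a = 0
    rw [HClass.comp_assoc]
    exact (congrArg g.1.comp (f.2 A hA a)).trans (HClass.comp_zero _)⟩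
  zero := ⟨0, fun _ _ a => HClass.zero_comp a⟩
  mul_assoc a b c := Subtype.ext (mul_assoc a.1 b.1 c.1)
  zero_mul a := Subtype.ext (zero_mul a.1)
  mul_zero a := Subtype.ext (mul_zero a.1)

end BasedSpace

/-- The nilpotency of a pointed semigroup `S`: the least `n ≥ 1` such that every product
`x₁ ⋯ xₙ` of `n` elements is `0`, and `∞` if there is no such `n`. -/
noncomputable def semigroupNilpotency (S : Type*) [SemigroupWithZero S] : ℕ∞ :=
  sInf {N : ℕ∞ | ∃ n : ℕ, 1 ≤ n ∧ N = n ∧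
    ∀ (x : S) (l : List S), l.length + 1 = n → l.foldl (· * ·) x = 0}

open Classical in
/-- The nilpotency `t_F(X)` of `X` mod `F`: it is `0` if `X` is contractible, and otherwise the
nilpotency of the pointed semigroup `Z_F(X)`. -/
noncomputable def BasedSpace.nilpotencyMod (F : Set BasedSpace.{u}) (X : BasedSpace.{u}) : ℕ∞ :=
  if ContractibleSpace X then 0 else semigroupNilpotency (BasedSpace.Z F X)

/-- The (unreduced) Lusternik-Schnirelmann category of a space: the least `n` such that `X` is
covered by `n` open sets each of which is contractible in `X`, and `∞` if there is no such `n`. -/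
noncomputable def lsCategory (X : Type*) [TopologicalSpace X] : ℕ∞ :=
  sInf {N : ℕ∞ | ∃ n : ℕ, N = n ∧ ∃ U : Fin n → Set X, (∀ i, IsOpen (U i)) ∧
    (⋃ i, U i) = Set.univ ∧
    ∀ i, (⟨Subtype.val, continuous_subtype_val⟩ : C(U i, X)).Nullhomotopic}

/-! Composing with one `Σ`-trivial map doubles the number of sets of a categorical cover that can be
merged. Let `G : Y → X` be null-homotopic on two open sets. Over their intersection the two
null-homotopies join to a family of loops at the base point, the loop at `y` passing through `G y`
at time `1/2`. Sliding along these loops deforms `G`, on the union, to a map `y ↦ ω_y (ρ y)` with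
`ρ` valued in `[0,1]`; this map is constant wherever only one of the two null-homotopies is
available. A `Σ`-trivial `f` contracts the whole family of loops relative to its end points, so `f ∘
G` is null-homotopic on the union (`NullOn.union`). With `c ≤ 2 ^ n` sets, `n` maps therefore
suffice (`OpenDomination.nullOn_sum`).

The difficulty is that `Σ`-triviality concerns suspensions of spaces of CW type, while the loops are
parametrized by an arbitrary space. The remedy is in the spirit of Milnor's theorem on loop spaces:
the family should factor, up to homotopy, through a parameter space of CW type. To this end `X` is
dominated by an open subset `W` of a normed space. Loops in `W` form an open subset of a normed
space of loops, and such a set is dominated by the nerve `N` of a cover by balls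
(`exists_cw_domination`). The family of loops, composed with `f`, then becomes homotopic to one
pulled back from a map `ΣN → X` followed by `f`, which is null
(`BasedSpace.comp_loops_homotopicRel_const`).

The domination by `W` (`exists_open_model`) is built one dimension at a time inside a single
sup-normed space with a separate group of coordinates for each dimension. At stage `n` the open set
is a cylinder over the first `n` groups, so there is always room to attach thickened `n`-cells in
the next group. Passing to `W` also supplies partitions of unity, local path-connectedness and a
convex neighbourhood of the base point; the last one turns free null-homotopies into based ones
(`NullOn.homotopicRel_const`). -/

open Set Metric Topology

/-! ### Nerves as cubical CW complexes -/

/-- The set underlying the cubical realization of a family `F` of finite sets of vertices: functions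
to `[0,1]` whose support lies in a member of `F` and which take the value `1`. -/
def cubicalCarrier {V : Type u} (F : Set (Finset V)) : Set (V → ℝ) :=
  {x | (∃ s ∈ F, ∀ v ∉ s, x v = 0) ∧ (∀ v, x v ∈ Icc (0 : ℝ) 1) ∧ ∃ v, x v = 1}

/-- The cubical realization of a family of finite sets. -/
def CubicalNerve {V : Type u} (F : Set (Finset V)) : Type u := cubicalCarrier F

namespace CubicalNerve

variable {V : Type u} {F : Set (Finset V)}

/-- The value of a point of the realization at a vertex. -/
def coord (x : CubicalNerve F) (v : V) : ℝ := x.1 v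

theorem coord_mem (x : CubicalNerve F) (v : V) : x.coord v ∈ Icc (0 : ℝ) 1 := x.2.2.1 v

theorem ext' {x y : CubicalNerve F} (h : ∀ v, x.coord v = y.coord v) : x = y :=
  Subtype.ext (funext h)

/-- The `n`-cells: pairs `(A, B)` of disjoint finite sets with `A ∪ B ∈ F`, `A ≠ ∅`, `#B = n`. -/
def Cell (F : Set (Finset V)) (n : ℕ) : Type u :=
  {p : Finset V × Finset V // Disjoint p.1 p.2 ∧ p.1.Nonempty ∧ p.2.card = n ∧
    ∃ s ∈ F, p.1 ⊆ s ∧ p.2 ⊆ s}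

/-- Clamping a real number to `[-1, 1]` and rescaling to `[0, 1]`. -/
noncomputable def clampHalf (t : ℝ) : ℝ := (1 + max (-1) (min 1 t)) / 2

theorem continuous_clampHalf : Continuous clampHalf := by unfold clampHalf; fun_prop

theorem clampHalf_mem (t : ℝ) : clampHalf t ∈ Icc (0 : ℝ) 1 := by
  unfold clampHalf
  have h1 : -1 ≤ max (-1) (min 1 t) := le_max_left _ _
  have h2 : max (-1) (min 1 t) ≤ 1 := max_le (by norm_num) (min_le_left _ _)
  constructor <;> linarith

theorem clampHalf_eq {t : ℝ} (h1 : -1 ≤ t) (h2 : t ≤ 1) : clampHalf t = (1 + t) / 2 := by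
  unfold clampHalf
  rw [min_eq_right h2, max_eq_right h1]

open Classical in
/-- The coordinates of the characteristic map of a cell. -/
noncomputable def charFun {n : ℕ} (c : Cell F n) (y : Fin n → ℝ) (v : V) : ℝ :=
  if v ∈ c.1.1 then 1 else
    if h : v ∈ c.1.2 then clampHalf (y (c.1.2.equivFinOfCardEq c.2.2.2.1 ⟨v, h⟩)) else 0

theorem charFun_mem {n : ℕ} (c : Cell F n) (y : Fin n → ℝ) : charFun c y ∈ cubicalCarrier F := by
  obtain ⟨s, hs, h1, h2⟩ := c.2.2.2.2
  refine ⟨⟨s, hs, fun v hv => ?_⟩, fun v => ?_, ?_⟩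
  · have h3 : v ∉ c.1.1 := fun h => hv (h1 h)
    have h4 : v ∉ c.1.2 := fun h => hv (h2 h)
    simp [charFun, h3, h4]
  · unfold charFun
    split_ifs
    · simp
    · exact clampHalf_mem _
    · simp
  · obtain ⟨v, hv⟩ := c.2.2.1
    exact ⟨v, by simp [charFun, hv]⟩

/-- The characteristic map of a cell, extended to all of `ℝⁿ` by clamping. -/
noncomputable def char {n : ℕ} (c : Cell F n) (y : Fin n → ℝ) : CubicalNerve F :=
  ⟨charFun c y, charFun_mem c y⟩

/-- The weak topology. -/
noncomputable instance : TopologicalSpace (CubicalNerve F) :=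
  ⨆ c : Σ n, Cell F n, TopologicalSpace.coinduced (char c.2) inferInstance

theorem continuous_dom_iff {Z : Type*} [TopologicalSpace Z] {f : CubicalNerve F → Z} :
    Continuous f ↔ ∀ (n : ℕ) (c : Cell F n), Continuous (f ∘ char c) := by
  rw [continuous_iSup_dom]
  simp only [continuous_coinduced_dom, Sigma.forall]

theorem continuous_char {n : ℕ} (c : Cell F n) : Continuous (char c) :=
  continuous_dom_iff.1 continuous_id n c

theorem isClosed_iff {A : Set (CubicalNerve F)} :
    IsClosed A ↔ ∀ (n : ℕ) (c : Cell F n), IsClosed (char c ⁻¹' A) := by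
  rw [isClosed_iSup_iff]
  simp only [isClosed_coinduced, Sigma.forall]

theorem continuous_coord (v : V) : Continuous fun x : CubicalNerve F => x.coord v := by
  rw [continuous_dom_iff]
  intro n c
  change Continuous fun y => charFun c y v
  unfold charFun
  split_ifs
  · exact continuous_const
  · exact continuous_clampHalf.comp (continuous_apply _)
  · exact continuous_const

instance : T2Space (CubicalNerve F) :=
  T2Space.of_injective_continuous (f := fun x : CubicalNerve F => x.coord)
    (fun _ _ h => ext' (congrFun h)) (continuous_pi continuous_coord)

/-- The vertices at which a point takes the value `1`. -/
noncomputable def ones (x : CubicalNerve F) : Finset V :=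
  Set.Finite.toFinset (s := {v | x.coord v = 1}) <| by
    obtain ⟨s, -, hs⟩ := x.2.1
    refine s.finite_toSet.subset fun v hv => ?_
    by_contra h
    have h2 : x.coord v = 1 := hv
    have h3 : x.coord v = 0 := hs v h
    linarith

/-- The vertices at which a point takes a value in `(0, 1)`. -/
noncomputable def mids (x : CubicalNerve F) : Finset V :=
  Set.Finite.toFinset (s := {v | 0 < x.coord v ∧ x.coord v < 1}) <| by
    obtain ⟨s, -, hs⟩ := x.2.1
    refine s.finite_toSet.subset fun v hv => ?_
    by_contra h
    have h2 : 0 < x.coord v := hv.1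
    have h3 : x.coord v = 0 := hs v h
    linarith

theorem mem_ones {x : CubicalNerve F} {v : V} : v ∈ ones x ↔ x.coord v = 1 := by simp [ones]

theorem mem_mids {x : CubicalNerve F} {v : V} : v ∈ mids x ↔ 0 < x.coord v ∧ x.coord v < 1 := by
  simp [mids]

/-- The open cell containing a point. -/
noncomputable def cellOf (x : CubicalNerve F) : Cell F (mids x).card :=
  ⟨(ones x, mids x), by
    refine ⟨?_, ?_, rfl, ?_⟩
    · rw [Finset.disjoint_left]
      intro v h1 h2
      rw [mem_ones] at h1; rw [mem_mids] at h2; linarith [h2.2]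
    · obtain ⟨v, hv⟩ := x.2.2.2
      exact ⟨v, mem_ones.2 hv⟩
    · obtain ⟨s, hs, h⟩ := x.2.1
      refine ⟨s, hs, fun v hv => ?_, fun v hv => ?_⟩
      · by_contra h'
        have h3 : x.coord v = 0 := h v h'
        rw [mem_ones] at hv; linarith
      · by_contra h'
        have h3 : x.coord v = 0 := h v h'
        rw [mem_mids] at hv; linarith [hv.1]⟩

/-- The inverse of the characteristic map. -/
noncomputable def charInv {n : ℕ} (c : Cell F n) (x : CubicalNerve F) (i : Fin n) : ℝ :=
  2 * x.coord ((c.1.2.equivFinOfCardEq c.2.2.2.1).symm i).1 - 1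

theorem continuous_charInv {n : ℕ} (c : Cell F n) : Continuous (charInv c) :=
  continuous_pi fun _ => ((continuous_const.mul (continuous_coord _)).sub continuous_const)

theorem coord_char_of_mem_left {n : ℕ} (c : Cell F n) (y : Fin n → ℝ) {v : V} (h : v ∈ c.1.1) :
    (char c y).coord v = 1 := by
  change charFun c y v = 1
  simp [charFun, h]

theorem coord_char_of_mem_right {n : ℕ} (c : Cell F n) (y : Fin n → ℝ) {v : V} (h : v ∈ c.1.2) :
    (char c y).coord v = clampHalf (y (c.1.2.equivFinOfCardEq c.2.2.2.1 ⟨v, h⟩)) := by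
  change charFun c y v = _
  have h1 : v ∉ c.1.1 := fun h' => Finset.disjoint_left.1 c.2.1 h' h
  simp [charFun, h, h1]

theorem coord_char_of_notMem {n : ℕ} (c : Cell F n) (y : Fin n → ℝ) {v : V} (h : v ∉ c.1.1)
    (h' : v ∉ c.1.2) : (char c y).coord v = 0 := by
  change charFun c y v = _
  simp [charFun, h, h']

theorem charInv_char {n : ℕ} (c : Cell F n) {y : Fin n → ℝ} (hy : y ∈ closedBall (0 : Fin n → ℝ) 1) :
    charInv c (char c y) = y := by
  funext i
  have hm := ((c.1.2.equivFinOfCardEq c.2.2.2.1).symm i).2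
  have hy' : |y i| ≤ 1 := by
    rw [mem_closedBall, dist_zero_right] at hy
    exact (norm_le_pi_norm y i).trans hy
  rw [abs_le] at hy'
  rw [charInv, coord_char_of_mem_right c y hm]
  simp only [Subtype.coe_eta, Equiv.apply_symm_apply]
  rw [clampHalf_eq hy'.1 hy'.2]
  ring

theorem charInv_mem {n : ℕ} (c : Cell F n) (x : CubicalNerve F) :
    charInv c x ∈ closedBall (0 : Fin n → ℝ) 1 := by
  rw [mem_closedBall, dist_zero_right, pi_norm_le_iff_of_nonneg zero_le_one]
  intro i
  have := x.coord_mem ((c.1.2.equivFinOfCardEq c.2.2.2.1).symm i).1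
  rw [Real.norm_eq_abs, abs_le, charInv]
  constructor <;> linarith [this.1, this.2]

theorem char_charInv {n : ℕ} (c : Cell F n) {x : CubicalNerve F}
    (h1 : ∀ v ∈ c.1.1, x.coord v = 1) (h2 : ∀ v, v ∉ c.1.1 → v ∉ c.1.2 → x.coord v = 0) :
    char c (charInv c x) = x := by
  refine ext' fun v => ?_
  by_cases hA : v ∈ c.1.1
  · rw [coord_char_of_mem_left c _ hA, h1 v hA]
  by_cases hB : v ∈ c.1.2
  · rw [coord_char_of_mem_right c _ hB]
    have := x.coord_mem v
    rw [clampHalf_eq]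
    · simp [charInv]
    · simp only [charInv, Equiv.symm_apply_apply]; linarith [this.1]
    · simp only [charInv, Equiv.symm_apply_apply]; linarith [this.2]
  · rw [coord_char_of_notMem c _ hA hB, h2 v hA hB]

theorem char_cellOf (x : CubicalNerve F) : char (cellOf x) (charInv (cellOf x) x) = x := by
  refine char_charInv _ (fun v hv => mem_ones.1 hv) fun v h1 h2 => ?_
  have := x.coord_mem v
  change v ∉ ones x at h1
  change v ∉ mids x at h2
  rw [mem_ones] at h1
  rw [mem_mids] at h2
  by_contra h
  exact h2 ⟨lt_of_le_of_ne this.1 (Ne.symm h), lt_of_le_of_ne this.2 h1⟩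

theorem abs_lt_of_mem_ball {n : ℕ} {y : Fin n → ℝ} (hy : y ∈ ball (0 : Fin n → ℝ) 1) (i : Fin n) :
    |y i| < 1 := by
  rw [mem_ball, dist_zero_right] at hy
  exact (norm_le_pi_norm y i).trans_lt hy

theorem ones_char {n : ℕ} (c : Cell F n) {y : Fin n → ℝ} (hy : y ∈ ball (0 : Fin n → ℝ) 1) :
    ones (char c y) = c.1.1 := by
  ext v
  rw [mem_ones]
  refine ⟨fun h => ?_, coord_char_of_mem_left c y⟩
  by_contra hA
  by_cases hB : v ∈ c.1.2
  · rw [coord_char_of_mem_right c y hB] at h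
    have := abs_lt.1 (abs_lt_of_mem_ball hy (c.1.2.equivFinOfCardEq c.2.2.2.1 ⟨v, hB⟩))
    rw [clampHalf_eq this.1.le this.2.le] at h
    linarith [this.2]
  · rw [coord_char_of_notMem c y hA hB] at h
    exact zero_ne_one h

theorem mids_char {n : ℕ} (c : Cell F n) {y : Fin n → ℝ} (hy : y ∈ ball (0 : Fin n → ℝ) 1) :
    mids (char c y) = c.1.2 := by
  ext v
  rw [mem_mids]
  constructor
  · intro h
    by_contra hB
    by_cases hA : v ∈ c.1.1
    · rw [coord_char_of_mem_left c y hA] at h; linarith [h.2]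
    · rw [coord_char_of_notMem c y hA hB] at h; linarith [h.1]
  · intro hB
    rw [coord_char_of_mem_right c y hB]
    have := abs_lt.1 (abs_lt_of_mem_ball hy (c.1.2.equivFinOfCardEq c.2.2.2.1 ⟨v, hB⟩))
    rw [clampHalf_eq this.1.le this.2.le]
    constructor <;> linarith [this.1, this.2]

/-- The finite set of cells in the closure of a cell. -/
theorem finite_faces {n : ℕ} (c : Cell F n) (m : ℕ) :
    {d : Cell F m | (∀ v ∈ d.1.1, v ∈ c.1.1 ∨ v ∈ c.1.2) ∧ d.1.2 ⊆ c.1.2}.Finite := by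
  classical
  refine Set.Finite.of_finite_image (f := Subtype.val) ?_ Subtype.val_injective.injOn
  refine ((c.1.1 ∪ c.1.2).powerset ×ˢ c.1.2.powerset).finite_toSet.subset ?_
  rintro _ ⟨d, ⟨h1, h2⟩, rfl⟩
  simp only [Finset.coe_product, mem_prod, Finset.mem_coe, Finset.mem_powerset]
  exact ⟨fun v hv => Finset.mem_union.2 (h1 v hv), h2⟩

/-- Because of the clamping, `char c` takes all its values on the closed cell, so the preimage of
`A` only depends on the part of `A` in that cell. -/
theorem closed_of_inter {A : Set (CubicalNerve F)}
    (h : ∀ (n : ℕ) (c : Cell F n), IsClosed (A ∩ char c '' closedBall 0 1)) : IsClosed A := by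
  rw [isClosed_iff]
  intro n c
  have h1 : char c ⁻¹' A = char c ⁻¹' (A ∩ char c '' closedBall 0 1) := by
    ext y
    simp only [mem_preimage, mem_inter_iff, iff_self_and]
    intro _
    refine ⟨charInv c (char c y), charInv_mem _ _, char_charInv c ?_ ?_⟩
    · exact fun v hv => coord_char_of_mem_left c y hv
    · exact fun v h1 h2 => coord_char_of_notMem c y h1 h2
  rw [h1]
  exact (h n c).preimage (continuous_char c)

/-- The CW structure of the cubical realization. -/
@[reducible]
noncomputable def cwComplex (F : Set (Finset V)) :
    Topology.CWComplex (Set.univ : Set (CubicalNerve F)) where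
  cell n := Cell F n
  map n c :=
    { toFun := char c
      invFun := charInv c
      source := ball 0 1
      target := char c '' ball 0 1
      map_source' := fun y hy => mem_image_of_mem _ hy
      map_target' := by
        rintro _ ⟨y, hy, rfl⟩
        rwa [charInv_char c (ball_subset_closedBall hy)]
      left_inv' := fun y hy => charInv_char c (ball_subset_closedBall hy)
      right_inv' := by
        rintro _ ⟨y, hy, rfl⟩
        rw [charInv_char c (ball_subset_closedBall hy)] }
  source_eq n c := rfl
  continuousOn n c := (continuous_char c).continuousOn
  continuousOn_symm n c := (continuous_charInv c).continuousOn
  pairwiseDisjoint' := by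
    rintro ⟨n, c⟩ - ⟨m, d⟩ - hne
    rw [Function.onFun, Set.disjoint_left]
    rintro x ⟨y, hy, rfl⟩ ⟨z, hz, hzy⟩
    apply hne
    change char d z = char c y at hzy
    -- An interior point of a cube determines its cell: the coordinates equal to `1` give the first
    -- set, those strictly between `0` and `1` the second.
    have h1 : c.1 = d.1 := by
      refine Prod.ext ?_ ?_
      · rw [← ones_char c hy, ← ones_char d hz, hzy]
      · rw [← mids_char c hy, ← mids_char d hz, hzy]
    have h2 : n = m := by rw [← c.2.2.2.1, ← d.2.2.2.1, h1]
    subst h2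
    exact congrArg _ (Subtype.ext h1)
  mapsTo' n c := by
    refine ⟨fun m => (finite_faces c m).toFinset, fun y hy => ?_⟩
    change char c y ∈ _
    have hsub : mids (char c y) ⊆ c.1.2 := by
      intro v hv
      rw [mem_mids] at hv
      by_contra hB
      by_cases hA : v ∈ c.1.1
      · rw [coord_char_of_mem_left c y hA] at hv; linarith [hv.2]
      · rw [coord_char_of_notMem c y hA hB] at hv; linarith [hv.1]
    -- A point of the sphere for the sup norm has some coordinate `±1`, so at least one free vertex
    -- takes the value `0` or `1` and the dimension of the open cell drops.
    have hne : mids (char c y) ≠ c.1.2 := by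
      intro heq
      have hlt : ∀ i, |y i| < 1 := by
        intro i
        have hm := ((c.1.2.equivFinOfCardEq c.2.2.2.1).symm i).2
        have h2 := mem_mids.1 (heq.symm.subset hm)
        rw [coord_char_of_mem_right c y hm] at h2
        simp only [Subtype.coe_eta, Equiv.apply_symm_apply] at h2
        have hy' : |y i| ≤ 1 := by
          rw [mem_sphere, dist_zero_right] at hy
          exact (norm_le_pi_norm y i).trans hy.le
        rw [abs_le] at hy'
        rw [clampHalf_eq hy'.1 hy'.2] at h2
        rw [abs_lt]
        constructor <;> linarith [h2.1, h2.2]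
      rw [mem_sphere, dist_zero_right] at hy
      have : ‖y‖ < 1 := (pi_norm_lt_iff zero_lt_one).2 hlt
      linarith
    have hcard : (mids (char c y)).card < n := by
      have := Finset.card_lt_card (Finset.ssubset_iff_subset_ne.2 ⟨hsub, hne⟩)
      rwa [c.2.2.2.1] at this
    simp only [mem_iUnion]
    refine ⟨(mids (char c y)).card, hcard, cellOf (char c y), ?_, charInv (cellOf (char c y)) (char c y), charInv_mem _ _, char_cellOf _⟩
    rw [Set.Finite.mem_toFinset]
    refine ⟨fun v hv => ?_, hsub⟩
    have hv' : (char c y).coord v = 1 := mem_ones.1 hv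
    by_contra hcon
    rw [not_or] at hcon
    rw [coord_char_of_notMem c y hcon.1 hcon.2] at hv'
    exact zero_ne_one hv'
  closed' A _ h := closed_of_inter h
  union' := by
    refine eq_univ_of_forall fun x => ?_
    simp only [mem_iUnion]
    exact ⟨_, cellOf x, charInv (cellOf x) x, charInv_mem _ _, char_cellOf x⟩

/-- Continuity of a map into the realization with locally finite coordinates. -/
theorem continuous_of_locallyFinite {Z : Type*} [TopologicalSpace Z] {f : Z → CubicalNerve F}
    (hf : ∀ v, Continuous fun z => (f z).coord v)
    (hloc : LocallyFinite fun v => Function.support fun z => (f z).coord v) : Continuous f := by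
  -- The last condition, membership in closures of supports, makes this closed cover locally finite:
  -- without it, a cell could be enlarged by arbitrary vertices at which the point vanishes.
  let E : (Σ n, Cell F n) → Set Z := fun c =>
    {z | (∀ v ∈ c.2.1.1, (f z).coord v = 1) ∧ (∀ v, v ∉ c.2.1.1 → v ∉ c.2.1.2 → (f z).coord v = 0) ∧
      ∀ v ∈ c.2.1.2, z ∈ closure (Function.support fun z => (f z).coord v)}
  have hsupp : ∀ c, ∀ z ∈ E c, ∀ v, v ∈ c.2.1.1 ∨ v ∈ c.2.1.2 →
      z ∈ closure (Function.support fun z => (f z).coord v) := by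
    rintro c z hz v (hv | hv)
    · refine subset_closure ?_
      rw [Function.mem_support, hz.1 v hv]
      exact one_ne_zero
    · exact hz.2.2 v hv
  refine LocallyFinite.continuous (f := E) ?_ ?_ ?_ ?_
  · intro z
    obtain ⟨U, hU, hfin⟩ := hloc.closure z
    refine ⟨U, hU, ?_⟩
    let T := hfin.toFinset
    refine Set.Finite.of_finite_image (f := fun c : Σ n, Cell F n => c.2.1) ?_ ?_
    · refine (T.powerset ×ˢ T.powerset).finite_toSet.subset ?_
      rintro _ ⟨c, ⟨w, hw, hwU⟩, rfl⟩
      simp only [Finset.coe_product, mem_prod, Finset.mem_coe, Finset.mem_powerset]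
      refine ⟨fun v hv => ?_, fun v hv => ?_⟩
      · rw [Set.Finite.mem_toFinset]
        exact ⟨w, hsupp c w hw v (Or.inl hv), hwU⟩
      · rw [Set.Finite.mem_toFinset]
        exact ⟨w, hsupp c w hw v (Or.inr hv), hwU⟩
    · rintro ⟨n, c⟩ - ⟨m, d⟩ - h
      have h1 : c.1 = d.1 := h
      have h2 : n = m := by rw [← c.2.2.2.1, ← d.2.2.2.1, h1]
      subst h2
      exact congrArg _ (Subtype.ext h1)
  · refine eq_univ_of_forall fun z => mem_iUnion.2 ⟨⟨_, cellOf (f z)⟩, ?_, ?_, ?_⟩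
    · exact fun v hv => mem_ones.1 hv
    · intro v h1 h2
      change v ∉ ones (f z) at h1
      change v ∉ mids (f z) at h2
      rw [mem_ones] at h1
      rw [mem_mids] at h2
      have := (f z).coord_mem v
      by_contra h
      exact h2 ⟨lt_of_le_of_ne this.1 (Ne.symm h), lt_of_le_of_ne this.2 h1⟩
    · intro v hv
      change v ∈ mids (f z) at hv
      exact subset_closure (mem_mids.1 hv).1.ne'
  · intro c
    have h1 : E c = (⋂ v ∈ c.2.1.1, {z | (f z).coord v = 1}) ∩
        ((⋂ v, ⋂ (_ : v ∉ c.2.1.1), ⋂ (_ : v ∉ c.2.1.2), {z | (f z).coord v = 0}) ∩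
        ⋂ v ∈ c.2.1.2, closure (Function.support fun z => (f z).coord v)) := by
      ext z; simp [E]
    rw [h1]
    refine IsClosed.inter ?_ (IsClosed.inter ?_ ?_)
    · exact isClosed_biInter fun v _ => isClosed_eq (hf v) continuous_const
    · exact isClosed_iInter fun v => isClosed_iInter fun _ => isClosed_iInter fun _ =>
        isClosed_eq (hf v) continuous_const
    · exact isClosed_biInter fun v _ => isClosed_closure
  · intro c
    have h1 : Continuous fun z => char c.2 (charInv c.2 (f z)) := by
      refine (continuous_char c.2).comp (continuous_pi fun i => ?_)
      exact (continuous_const.mul (hf _)).sub continuous_const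
    exact h1.continuousOn.congr fun z hz => (char_charInv c.2 hz.1 hz.2.1).symm

end CubicalNerve

/-! ### Affine maps from a nerve to a normed space -/

namespace CubicalNerve

variable {V : Type u} {F : Set (Finset V)}

/-- The vertices at which a point does not vanish. -/
noncomputable def supp (x : CubicalNerve F) : Finset V :=
  Set.Finite.toFinset (s := {v | x.coord v ≠ 0}) <| by
    obtain ⟨s, -, hs⟩ := x.2.1
    refine s.finite_toSet.subset fun v hv => ?_
    by_contra h
    exact hv (hs v h)

theorem mem_supp {x : CubicalNerve F} {v : V} : v ∈ supp x ↔ x.coord v ≠ 0 := by simp [supp]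

/-- The affine extension of a function on vertices. -/
noncomputable def affineMap {E : Type*} [NormedAddCommGroup E] [NormedSpace ℝ E] (z : V → E)
    (x : CubicalNerve F) : E := (supp x).centerMass x.coord z

theorem sum_supp_pos (x : CubicalNerve F) : 0 < ∑ v ∈ supp x, x.coord v := by
  obtain ⟨v, hv⟩ := x.2.2.2
  have hv' : x.coord v = 1 := hv
  refine Finset.sum_pos' (fun v _ => (x.coord_mem v).1) ⟨v, ?_, ?_⟩
  · rw [mem_supp, hv']; exact one_ne_zero
  · rw [hv']; exact one_pos

/-- The support varies with the point; summing over a fixed larger set gives one formula valid on a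
whole closed cell, from which continuity is read off. -/
theorem affineMap_eq {E : Type*} [NormedAddCommGroup E] [NormedSpace ℝ E] (z : V → E)
    {x : CubicalNerve F} {s : Finset V} (hs : supp x ⊆ s) :
    affineMap z x = (∑ v ∈ s, x.coord v)⁻¹ • ∑ v ∈ s, x.coord v • z v := by
  have h0 : ∀ v ∈ s, v ∉ supp x → x.coord v = 0 := fun v _ h => by
    rw [mem_supp, not_not] at h; exact h
  rw [affineMap, Finset.centerMass, Finset.sum_subset hs h0,
    Finset.sum_subset hs fun v hv h => by rw [h0 v hv h, zero_smul]]

theorem continuous_affineMap {E : Type*} [NormedAddCommGroup E] [NormedSpace ℝ E] (z : V → E) :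
    Continuous (affineMap (F := F) z) := by
  classical
  rw [continuous_dom_iff]
  intro n c
  have hsub : ∀ y, supp (char c y) ⊆ c.1.1 ∪ c.1.2 := by
    intro y v hv
    rw [mem_supp] at hv
    by_contra h
    rw [Finset.mem_union, not_or] at h
    exact hv (coord_char_of_notMem c y h.1 h.2)
  have h1 : affineMap z ∘ char c = fun y => (∑ v ∈ c.1.1 ∪ c.1.2, (char c y).coord v)⁻¹ •
      ∑ v ∈ c.1.1 ∪ c.1.2, (char c y).coord v • z v :=
    funext fun y => affineMap_eq z (hsub y)
  rw [h1]
  have hc : ∀ v, Continuous fun y => (char c y).coord v := fun v =>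
    (continuous_coord v).comp (continuous_char c)
  refine Continuous.smul (Continuous.inv₀ (continuous_finsetSum _ fun v _ => hc v) fun y => ?_)
    (continuous_finsetSum _ fun v _ => (hc v).smul continuous_const)
  refine ne_of_gt ((sum_supp_pos (char c y)).trans_le ?_)
  exact Finset.sum_le_sum_of_subset_of_nonneg (hsub y) fun v _ _ => (coord_mem _ v).1

theorem affineMap_mem {E : Type*} [NormedAddCommGroup E] [NormedSpace ℝ E] {z : V → E}
    {x : CubicalNerve F} {D : Set E} (hD : Convex ℝ D) (h : ∀ v, x.coord v ≠ 0 → z v ∈ D) :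
    affineMap z x ∈ D :=
  hD.centerMass_mem (fun v _ => (x.coord_mem v).1) (sum_supp_pos x)
    fun v hv => h v (mem_supp.1 hv)

end CubicalNerve

/-! ### CW domination of open subsets of normed spaces -/

/-- On an open subset of a normed space there is a `1`-Lipschitz choice of radii of balls
contained in the subset. -/
theorem exists_lipschitz_radius {E : Type*} [NormedAddCommGroup E] {O : Set E} (hO : IsOpen O) :
    ∃ ρ : E → ℝ, (∀ x ∈ O, 0 < ρ x) ∧ (∀ x, ball x (ρ x) ⊆ O) ∧ ∀ x y, ρ x ≤ ρ y + dist x y := by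
  by_cases h : O = univ
  · subst h
    exact ⟨fun _ => 1, by simp, by simp, fun x y => by simp⟩
  · have hne : (Oᶜ).Nonempty := nonempty_compl.2 h
    refine ⟨fun x => infDist x Oᶜ, fun x hx => ?_, fun x => ball_infDist_compl_subset, fun x y => infDist_le_infDist_add_dist⟩
    exact (hO.isClosed_compl.notMem_iff_infDist_pos hne).1 (not_not.2 hx)

/-- The family of vertex sets of the nerve of the cover of `O` by the balls of radius `ρ / 4`,
together with an additional isolated vertex. -/
def ballNerveFaces {E : Type u} [NormedAddCommGroup E] (O : Set E) (ρ : E → ℝ) :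
    Set (Finset (Option O)) :=
  {s | (∀ v ∈ s, v = none) ∨ ∃ x : O, ∀ v ∈ s, ∃ c : O, v = some c ∧ dist (x : E) c < ρ c / 4}

/-- An open subset of a normed space containing `0` is dominated by a CW complex whose base point
is sent to `0`. -/
theorem exists_cw_domination {E : Type u} [NormedAddCommGroup E] [NormedSpace ℝ E] {O : Set E}
    (hO : IsOpen O) (h0 : (0 : E) ∈ O) :
    ∃ N : BasedSpace.{u}, N.HasCWType ∧ ∃ (i : C(O, N)) (p : C(N, O)), p N.pt = ⟨0, h0⟩ ∧
      (p.comp i).Homotopic (ContinuousMap.id O) := by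
  classical
  obtain ⟨ρ, hρ0, hρ1, hρ2⟩ := exists_lipschitz_radius hO
  set F := ballNerveFaces O ρ with hF
  -- By the Lipschitz property `ρ c ≤ ρ x + ρ c / 4`, so `ρ c / 4 ≤ ρ x / 3`. Hence all vertices of
  -- a face witnessed by `x` lie in one ball around `x` that is contained in `O`, and convexity
  -- applies.
  have hclose : ∀ x c : E, dist x c < ρ c / 4 → c ∈ ball x (ρ x) := by
    intro x c h
    have h2 := hρ2 c x
    rw [dist_comm] at h2
    rw [mem_ball, dist_comm]
    have : 0 ≤ dist x c := dist_nonneg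
    linarith
  -- At each point some function of a bump covering equals `1`, which is exactly the normalization
  -- of `cubicalCarrier`; no division is needed.
  obtain ⟨b, hb⟩ := BumpCovering.exists_isSubordinate (X := O) (s := univ) isClosed_univ
    (fun c : O => {x : O | dist (x : E) c < ρ c / 4})
    (fun c => isOpen_lt (by fun_prop) continuous_const)
    (fun x _ => mem_iUnion.2 ⟨x, by
      have := hρ0 x x.2
      simp only [mem_ofPred_eq, dist_self]; positivity⟩)
  have hbU : ∀ (c x : O), b c x ≠ 0 → dist (x : E) c < ρ c / 4 := fun c x h =>
    hb c (subset_tsupport _ h)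
  -- the base point
  let pt : CubicalNerve F := ⟨Pi.single none 1, ⟨{none}, Or.inl (by simp), fun v hv => by
      rw [Finset.mem_singleton] at hv; exact Pi.single_eq_of_ne hv _⟩, fun v => by
      by_cases hv : v = none
      · subst hv; simp
      · rw [Pi.single_eq_of_ne hv]; simp, none, by simp⟩
  -- The extra vertex `none` lies in no face with another vertex, so it may be sent to `0` freely.
  -- It makes the nerve disconnected, which is harmless since suspensions of disconnected spaces are
  -- allowed.
  let z : Option O → E := fun v => v.elim 0 (fun c => c)
  -- the map to the nerve
  let iFun : O → CubicalNerve F := fun x => ⟨fun v => v.elim 0 fun c => b c x, by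
    refine ⟨⟨(b.point_finite x).toFinset.image some, Or.inr ⟨x, ?_⟩, ?_⟩, ?_, ?_⟩
    · intro v hv
      simp only [Finset.mem_image, Set.Finite.mem_toFinset, mem_ofPred_eq] at hv
      obtain ⟨c, hc, rfl⟩ := hv
      exact ⟨c, rfl, hbU c x hc⟩
    · rintro (_ | c) hv
      · rfl
      · by_contra h
        refine hv ?_
        simp only [Finset.mem_image, Set.Finite.mem_toFinset, mem_ofPred_eq]
        exact ⟨c, h, rfl⟩
    · rintro (_ | c)
      · simp
      · exact ⟨b.nonneg c x, b.le_one c x⟩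
    · exact ⟨some (b.ind x (mem_univ x)), b.ind_apply x (mem_univ x)⟩⟩
  have hi : Continuous iFun := by
    refine CubicalNerve.continuous_of_locallyFinite ?_ ?_
    · rintro (_ | c)
      · exact continuous_const
      · exact (b c).continuous
    · intro x
      obtain ⟨U, hU, hfin⟩ := b.locallyFinite x
      refine ⟨U, hU, (hfin.image some).subset ?_⟩
      rintro (_ | c) ⟨w, hw, hwU⟩
      · exact absurd rfl hw
      · exact ⟨c, ⟨w, hw, hwU⟩, rfl⟩
  have hp : ∀ n : CubicalNerve F, CubicalNerve.affineMap z n ∈ O := by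
    intro n
    obtain ⟨s, hs | ⟨x, hx⟩, hsn⟩ := n.2.1
    · have : CubicalNerve.affineMap z n ∈ ({0} : Set E) := by
        refine CubicalNerve.affineMap_mem (convex_singleton 0) fun v hv => ?_
        have hvs : v ∈ s := by
          by_contra h; exact hv (hsn v h)
        rw [hs v hvs]; rfl
      rw [mem_singleton_iff] at this
      rwa [this]
    · refine hρ1 x (CubicalNerve.affineMap_mem (convex_ball _ _) fun v hv => ?_)
      have hvs : v ∈ s := by
        by_contra h; exact hv (hsn v h)
      obtain ⟨c, rfl, hc⟩ := hx v hvs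
      exact hclose x c hc
  have hpi : ∀ x : O, CubicalNerve.affineMap z (iFun x) ∈ ball (x : E) (ρ x) := by
    intro x
    refine CubicalNerve.affineMap_mem (convex_ball _ _) ?_
    rintro (_ | c) hv
    · exact absurd rfl hv
    · exact hclose x c (hbU c x hv)
  refine ⟨⟨CubicalNerve F, pt⟩, ?_, ⟨iFun, hi⟩,
    ⟨fun n => ⟨CubicalNerve.affineMap z n, hp n⟩,
      (CubicalNerve.continuous_affineMap z).subtype_mk _⟩, ?_, ?_⟩
  · refine ⟨⟨CubicalNerve F, pt⟩, inferInstanceAs (T2Space (CubicalNerve F)),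
      ⟨CubicalNerve.cwComplex F, ?_⟩, BasedSpace.Map.id _, BasedSpace.Map.id _, ?_, ?_⟩
    · let c : CubicalNerve.Cell F 0 := ⟨({none}, ∅), by simp, by simp, by simp, {none},
        Or.inl (by simp), by simp, by simp⟩
      refine ⟨c, 0, by simp, ?_⟩
      refine CubicalNerve.ext' fun v => ?_
      change (CubicalNerve.char c 0).coord v = (Pi.single none 1 : Option O → ℝ) v
      by_cases hv : v = none
      · subst hv
        rw [CubicalNerve.coord_char_of_mem_left c 0 (by simp [c])]
        simp
      · rw [CubicalNerve.coord_char_of_notMem c 0 (by simp [c, hv]) (by simp [c]),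
          Pi.single_eq_of_ne hv]
    · exact ContinuousMap.HomotopicRel.refl _
    · exact ContinuousMap.HomotopicRel.refl _
  · refine Subtype.ext ?_
    change CubicalNerve.affineMap z pt = 0
    have : CubicalNerve.affineMap z pt ∈ ({0} : Set E) := by
      refine CubicalNerve.affineMap_mem (convex_singleton 0) fun v hv => ?_
      have : v = none := by
        by_contra h; exact hv (Pi.single_eq_of_ne h _)
      rw [this]; rfl
    exact this
  · have hball : ∀ (t : unitInterval) (x : O),
        (1 - (t : ℝ)) • CubicalNerve.affineMap z (iFun x) + (t : ℝ) • (x : E) ∈ O := by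
      intro t x
      refine hρ1 x ((convex_ball (x : E) (ρ x)) (hpi x) (mem_ball_self (hρ0 x x.2)) ?_ t.2.1 ?_)
      · linarith [t.2.2]
      · ring
    refine ⟨⟨⟨fun q => ⟨_, hball q.1 q.2⟩, ?_⟩, ?_, ?_⟩⟩
    · have := CubicalNerve.continuous_affineMap (F := F) z
      refine Continuous.subtype_mk ?_ _
      fun_prop
    · intro x
      refine Subtype.ext ?_
      simp
    · intro x
      refine Subtype.ext ?_
      simp

/-! ### The ambient normed space for attaching cells -/

/-- Bounded real functions on a set of indices, with the supremum norm. -/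
def TagSpace (I : Type u) : Type u := lp (fun _ : I => ℝ) ⊤

noncomputable instance (I : Type u) : NormedAddCommGroup (TagSpace I) :=
  inferInstanceAs (NormedAddCommGroup (lp (fun _ : I => ℝ) ⊤))

noncomputable instance (I : Type u) : NormedSpace ℝ (TagSpace I) :=
  inferInstanceAs (NormedSpace ℝ (lp (fun _ : I => ℝ) ⊤))

/-- The coordinates used for attaching `n`-cells indexed by `J`: a point of `ℝⁿ`, a height, and
a bounded function recording the index of the cell. -/
def AttachCoord (J : ℕ → Type u) (n : ℕ) : Type u := (Fin n → ℝ) × ℝ × TagSpace (J n)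

noncomputable instance (J : ℕ → Type u) (n : ℕ) : NormedAddCommGroup (AttachCoord J n) :=
  inferInstanceAs (NormedAddCommGroup ((Fin n → ℝ) × ℝ × TagSpace (J n)))

noncomputable instance (J : ℕ → Type u) (n : ℕ) : NormedSpace ℝ (AttachCoord J n) :=
  inferInstanceAs (NormedSpace ℝ ((Fin n → ℝ) × ℝ × TagSpace (J n)))

/-- The ambient normed space of the open model of a CW complex with `n`-cells `J n`. -/
def ModelSpace (J : ℕ → Type u) : Type u := lp (AttachCoord J) ⊤

noncomputable instance (J : ℕ → Type u) : NormedAddCommGroup (ModelSpace J) :=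
  inferInstanceAs (NormedAddCommGroup (lp (AttachCoord J) ⊤))

noncomputable instance (J : ℕ → Type u) : NormedSpace ℝ (ModelSpace J) :=
  inferInstanceAs (NormedSpace ℝ (lp (AttachCoord J) ⊤))

namespace ModelSpace

variable {J : ℕ → Type u}

/-- The `n`-th group of coordinates. -/
def coord (n : ℕ) (x : ModelSpace J) : AttachCoord J n := x.1 n

theorem ext_coord {x y : ModelSpace J} (h : ∀ n, coord n x = coord n y) : x = y :=
  Subtype.ext (funext h)

theorem coord_add (n : ℕ) (x y : ModelSpace J) : coord n (x + y) = coord n x + coord n y := rfl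

theorem coord_sub (n : ℕ) (x y : ModelSpace J) : coord n (x - y) = coord n x - coord n y := rfl

theorem coord_smul (n : ℕ) (c : ℝ) (x : ModelSpace J) : coord n (c • x) = c • coord n x := rfl

theorem norm_coord_le (n : ℕ) (x : ModelSpace J) : ‖coord n x‖ ≤ ‖x‖ :=
  lp.norm_apply_le_norm (E := AttachCoord J) ENNReal.top_ne_zero x n

theorem continuous_coord (n : ℕ) : Continuous (coord (J := J) n) := by
  have h : LipschitzWith 1 (coord (J := J) n) := by
    refine LipschitzWith.of_dist_le_mul fun x y => ?_
    rw [dist_eq_norm, dist_eq_norm, NNReal.coe_one, one_mul]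
    exact norm_coord_le n (x - y)
  exact h.continuous

/-- The inclusion of a group of coordinates. -/
noncomputable def incl (n : ℕ) (g : AttachCoord J n) : ModelSpace J :=
  lp.single (E := AttachCoord J) ⊤ n g

theorem continuous_incl (n : ℕ) : Continuous (incl (J := J) n) :=
  (lp.isometry_single (E := AttachCoord J) (p := ⊤) n).continuous

theorem incl_zero (n : ℕ) : incl n (0 : AttachCoord J n) = 0 :=
  lp.single_zero (E := AttachCoord J) ⊤ n

theorem coord_incl_self (n : ℕ) (g : AttachCoord J n) : coord n (incl n g) = g :=
  lp.single_apply_self (E := AttachCoord J) ⊤ n g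

theorem coord_incl_ne (n : ℕ) (g : AttachCoord J n) {k : ℕ} (h : k ≠ n) :
    coord k (incl n g) = 0 :=
  lp.single_apply_ne (E := AttachCoord J) ⊤ n g h

/-- `coord` as an additive homomorphism. -/
def coordHom (n : ℕ) : ModelSpace J →+ AttachCoord J n where
  toFun := coord n
  map_zero' := rfl
  map_add' _ _ := rfl

/-- The truncation to the first `n` groups of coordinates. -/
noncomputable def trunc (n : ℕ) (x : ModelSpace J) : ModelSpace J :=
  ∑ k ∈ Finset.range n, incl k (coord k x)

theorem continuous_trunc (n : ℕ) : Continuous (trunc (J := J) n) :=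
  continuous_finsetSum _ fun k _ => (continuous_incl k).comp (continuous_coord k)

theorem trunc_apply (n : ℕ) (x : ModelSpace J) (k : ℕ) :
    coord k (trunc n x) = if k < n then coord k x else 0 := by
  change coordHom k (trunc n x) = _
  rw [trunc, map_sum]
  split_ifs with h
  · rw [Finset.sum_eq_single k]
    · exact coord_incl_self k _
    · intro m _ hm
      exact coord_incl_ne m _ hm.symm
    · intro hk
      exact absurd (Finset.mem_range.2 h) hk
  · refine Finset.sum_eq_zero fun m hm => coord_incl_ne m _ ?_
    have := Finset.mem_range.1 hm
    omega

theorem trunc_of_le {n : ℕ} {x y : ModelSpace J} (h : ∀ k < n, coord k x = coord k y) : trunc n x = trunc n y :=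
  Finset.sum_congr rfl fun k hk => by rw [h k (Finset.mem_range.1 hk)]

theorem trunc_eq_self_iff {n : ℕ} {x : ModelSpace J} : trunc n x = x ↔ ∀ k, n ≤ k → coord k x = 0 := by
  constructor
  · intro h k hk
    rw [← h, trunc_apply, if_neg (by omega)]
  · intro h
    refine ext_coord fun k => ?_
    rw [trunc_apply]
    split_ifs with hk
    · rfl
    · exact (h k (by omega)).symm

/-- The point coordinate. -/
def pos (n : ℕ) (x : ModelSpace J) : Fin n → ℝ := (coord n x).1

/-- The height coordinate. -/
def height (n : ℕ) (x : ModelSpace J) : ℝ := (coord n x).2.1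

/-- The coordinate recording the index of a cell. -/
def tag (n : ℕ) (x : ModelSpace J) : TagSpace (J n) := (coord n x).2.2

theorem continuous_pos (n : ℕ) : Continuous (pos (J := J) n) := (continuous_coord n).fst

theorem continuous_height (n : ℕ) : Continuous (height (J := J) n) := (continuous_coord n).snd.fst

theorem continuous_tag (n : ℕ) : Continuous (tag (J := J) n) := (continuous_coord n).snd.snd

/-- The bound does not depend on `n`: a small move changes all heights by a uniformly small amount,
which makes the limit of the stages open. -/
theorem abs_height_sub_le (n : ℕ) (x y : ModelSpace J) : |height n x - height n y| ≤ ‖x - y‖ := by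
  refine le_trans ?_ (norm_coord_le n (x - y))
  rw [coord_sub]
  exact (norm_fst_le (coord n x - coord n y).2).trans (norm_snd_le (coord n x - coord n y))

open Classical in
/-- The tag of a cell. -/
noncomputable def basisTag {n : ℕ} (j : J n) : TagSpace (J n) :=
  lp.single (E := fun _ : J n => ℝ) ⊤ j (1 : ℝ)

/-- Distinct tags are at distance at least `1`, so the balls of radius `1/2` around them are
disjoint and the pieces attached for different cells do not interfere. -/
theorem tag_unique {n : ℕ} {q : TagSpace (J n)} {j k : J n} (hj : ‖q - basisTag j‖ < 1 / 2)
    (hk : ‖q - basisTag k‖ < 1 / 2) : j = k := by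
  classical
  by_contra h
  have h1 : ‖(basisTag j - basisTag k).1 j‖ ≤ ‖basisTag j - basisTag k‖ :=
    lp.norm_apply_le_norm (E := fun _ : J n => ℝ) ENNReal.top_ne_zero _ _
  have h2 : (basisTag j - basisTag k).1 j = 1 := by
    have h3 : (basisTag j).1 j = 1 := lp.single_apply_self (E := fun _ : J n => ℝ) ⊤ j 1
    have h4 : (basisTag k).1 j = 0 := lp.single_apply_ne (E := fun _ : J n => ℝ) ⊤ k 1 h
    change (basisTag j).1 j - (basisTag k).1 j = 1
    rw [h3, h4, sub_zero]
  rw [h2, norm_one] at h1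
  have h3 : basisTag j - basisTag k = (q - basisTag k) - (q - basisTag j) := by abel
  rw [h3] at h1
  have := norm_sub_le (q - basisTag k) (q - basisTag j)
  linarith

end ModelSpace

/-! ### Attaching cells to an open set -/

/-- The radial retraction of a normed space onto its closed unit ball. -/
noncomputable def ballRetraction {E : Type*} [NormedAddCommGroup E] [NormedSpace ℝ E] (z : E) : E :=
  (max 1 ‖z‖)⁻¹ • z

section ballRetraction

variable {E : Type*} [NormedAddCommGroup E] [NormedSpace ℝ E]

theorem continuous_ballRetraction : Continuous (ballRetraction (E := E)) :=
  ((continuous_const.max continuous_norm).inv₀ fun _ =>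
    (zero_lt_one.trans_le (le_max_left _ _)).ne').smul continuous_id

theorem norm_ballRetraction_le (z : E) : ‖ballRetraction z‖ ≤ 1 := by
  rw [ballRetraction, norm_smul, norm_inv, Real.norm_of_nonneg (le_max_of_le_left zero_le_one),
    inv_mul_le_iff₀ (zero_lt_one.trans_le (le_max_left _ _)), mul_one]
  exact le_max_right _ _

theorem ballRetraction_of_one_le {z : E} (h : 1 ≤ ‖z‖) : ballRetraction z = ‖z‖⁻¹ • z := by
  rw [ballRetraction, max_eq_right h]

theorem norm_normalize {z : E} (h : 0 < ‖z‖) : ‖‖z‖⁻¹ • z‖ = 1 := by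
  rw [norm_smul, norm_inv, norm_norm, inv_mul_cancel₀ h.ne']

theorem continuousOn_normalize : ContinuousOn (fun z : E => ‖z‖⁻¹ • z) {z | 0 < ‖z‖} :=
  ContinuousOn.smul (ContinuousOn.inv₀ continuous_norm.continuousOn fun _ h => (ne_of_gt h))
    continuousOn_id

theorem normalize_smul {z : E} {a : ℝ} (ha : 0 < a) : ‖a • z‖⁻¹ • a • z = ‖z‖⁻¹ • z := by
  rw [norm_smul, Real.norm_of_nonneg ha.le, smul_smul, mul_inv, mul_right_comm,
    inv_mul_cancel₀ ha.ne', one_mul]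

end ballRetraction

open ModelSpace

/-- Attaching cells to an open subset of the model space. -/
theorem exists_attach {J : ℕ → Type u} {K : Type*} [TopologicalSpace K] (n : ℕ)
    (W : Set (ModelSpace J)) (r : ModelSpace J → K) (hW : IsOpen W) (hr : ContinuousOn r W)
    (hWt : ∀ x, trunc n x ∈ W ↔ x ∈ W) (hrt : ∀ x, r (trunc n x) = r x)
    (γ : J n → (Fin n → ℝ) → ModelSpace J) (hγ : ∀ j, ContinuousOn (γ j) (sphere 0 1))
    (hγW : ∀ j, ∀ y ∈ sphere (0 : Fin n → ℝ) 1, γ j y ∈ W)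
    (hγt : ∀ j, ∀ y ∈ sphere (0 : Fin n → ℝ) 1, trunc n (γ j y) = γ j y)
    (δ : J n → (Fin n → ℝ) → K) (hδ : ∀ j, ContinuousOn (δ j) (closedBall 0 1))
    (hδγ : ∀ j, ∀ y ∈ sphere (0 : Fin n → ℝ) 1, δ j y = r (γ j y)) :
    ∃ (W' : Set (ModelSpace J)) (r' : ModelSpace J → K), IsOpen W' ∧ ContinuousOn r' W' ∧
      (∀ x, trunc (n + 1) x ∈ W' ↔ x ∈ W') ∧ (∀ x, r' (trunc (n + 1) x) = r' x) ∧
      (∀ x ∈ W, height n x < 1 → x ∈ W' ∧ r' x = r x) ∧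
      ∃ τ : J n → (Fin n → ℝ) → ModelSpace J, (∀ j, ContinuousOn (τ j) (closedBall 0 1)) ∧
        (∀ j, ∀ y ∈ closedBall (0 : Fin n → ℝ) 1, τ j y ∈ W' ∧ trunc (n + 1) (τ j y) = τ j y ∧
          r' (τ j y) = δ j (ballRetraction ((4 : ℝ) • y))) ∧
        ∀ j, ∀ y ∈ sphere (0 : Fin n → ℝ) 1, τ j y = γ j y := by
  classical
  have hε : ∀ j, ∃ ε : ℝ, 0 < ε ∧ ∀ y ∈ sphere (0 : Fin n → ℝ) 1, ball (γ j y) ε ⊆ W := by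
    intro j
    obtain ⟨ε, hε, h⟩ := ((isCompact_sphere (0 : Fin n → ℝ) 1).image_of_continuousOn
      (hγ j)).exists_thickening_subset_open hW (image_subset_iff.2 (hγW j))
    refine ⟨ε, hε, fun y hy => Subset.trans ?_ h⟩
    exact ball_subset_thickening (mem_image_of_mem _ hy) ε
  choose ε hε0 hεW using hε
  -- the direction of the point coordinate
  set dir : ModelSpace J → Fin n → ℝ := fun x => ‖pos n x‖⁻¹ • pos n x with hdir
  have hdirS : ∀ x, 1 < ‖pos n x‖ → dir x ∈ sphere (0 : Fin n → ℝ) 1 := fun x hx => by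
    rw [mem_sphere, dist_zero_right]
    exact norm_normalize (by linarith)
  have hUpos : IsOpen {x : ModelSpace J | 1 < ‖pos n x‖} :=
    isOpen_lt continuous_const (continuous_pos n).norm
  have hdirc : ContinuousOn dir {x | 1 < ‖pos n x‖} := by
    refine continuousOn_normalize.comp (continuous_pos n).continuousOn fun x hx => ?_
    have : 1 < ‖pos n x‖ := hx
    change 0 < ‖pos n x‖
    linarith
  have hγdir : ∀ j, ContinuousOn (fun x => γ j (dir x)) {x | 1 < ‖pos n x‖} := fun j =>
    (hγ j).comp hdirc fun x hx => hdirS x hx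
  -- the open pieces
  set U₁ : J n → Set (ModelSpace J) := fun j => {x | ‖tag n x - basisTag j‖ < 1 / 2 ∧ 2 < height n x}
    with hU₁
  set U₂ : J n → Set (ModelSpace J) := fun j => {x | ‖tag n x - basisTag j‖ < 1 / 2 ∧
    1 < ‖pos n x‖ ∧ ‖trunc n x - γ j (dir x)‖ < ε j} with hU₂
  set U₃ : Set (ModelSpace J) := {x | height n x < 1 ∧ x ∈ W} with hU₃
  have hoT : ∀ j, IsOpen {x : ModelSpace J | ‖tag n x - basisTag j‖ < 1 / 2} := fun j =>
    isOpen_lt ((continuous_tag n).sub continuous_const).norm continuous_const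
  have hoU₁ : ∀ j, IsOpen (U₁ j) := fun j =>
    (hoT j).inter (isOpen_lt continuous_const (continuous_height n))
  have hoU₂ : ∀ j, IsOpen (U₂ j) := by
    intro j
    refine (hoT j).inter ?_
    exact ((continuous_trunc n).continuousOn.sub (hγdir j)).norm.isOpen_inter_preimage hUpos
      isOpen_Iio
  have hoU₃ : IsOpen U₃ := (isOpen_lt (continuous_height n) continuous_const).inter hW
  -- Between heights `1` and `2` the first `n` groups of coordinates are moved linearly to the
  -- attaching point `γ j (dir x)`.
  set lam : ℝ → ℝ := fun t => max 0 (min 1 (t - 1)) with hlam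
  have hlam01 : ∀ t, 0 ≤ lam t ∧ lam t ≤ 1 := fun t =>
    ⟨le_max_left _ _, max_le zero_le_one (min_le_left _ _)⟩
  set lerp : J n → ModelSpace J → ModelSpace J := fun j x =>
    trunc n x + lam (height n x) • (γ j (dir x) - trunc n x) with hlerp
  set r' : ModelSpace J → K := fun x => if height n x < 1 then r x else
    if h : ∃ j, ‖tag n x - basisTag j‖ < 1 / 2 then
      (if height n x ≤ 2 then r (lerp h.choose x) else
        δ h.choose (ballRetraction (pos n x))) else r x with hr'
  have hr'j : ∀ x j, 1 ≤ height n x → ‖tag n x - basisTag j‖ < 1 / 2 →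
      r' x = if height n x ≤ 2 then r (lerp j x) else δ j (ballRetraction (pos n x)) := by
    intro x j hx hj
    have hex : ∃ j, ‖tag n x - basisTag j‖ < 1 / 2 := ⟨j, hj⟩
    have : hex.choose = j := tag_unique hex.choose_spec hj
    simp only [hr', if_neg (not_lt.2 hx), dif_pos hex, this]
  have hr'₁ : ∀ j, ∀ x ∈ U₁ j, r' x = δ j (ballRetraction (pos n x)) := by
    intro j x hx
    rw [hr'j x j (by linarith [hx.2]) hx.1, if_neg (not_le.2 hx.2)]
  have hr'₃ : ∀ x ∈ U₃, r' x = r x := by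
    intro x hx
    simp only [hr', if_pos hx.1]
  -- On the collar all formulas for `r'` agree: below height `1` the interpolation has not started,
  -- and above height `2` it has reached `γ j (dir x)`, where `hδγ` identifies `r` with `δ j`.
  have hr'₂ : ∀ j, ∀ x ∈ U₂ j, r' x = r (lerp j x) := by
    intro j x hx
    rcases lt_or_ge (height n x) 1 with h | h
    · have h0 : lam (height n x) = 0 := by
        simp only [hlam]
        rw [max_eq_left]
        exact (min_le_right _ _).trans (by linarith)
      simp only [hr', if_pos h, hlerp, h0, zero_smul, add_zero, hrt]
    · rw [hr'j x j h hx.1]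
      split_ifs with h2
      · rfl
      · have h1 : lam (height n x) = 1 := by
          simp only [hlam]
          rw [min_eq_left (by linarith), max_eq_right zero_le_one]
        simp only [hlerp, h1, one_smul, add_sub_cancel]
        rw [ballRetraction_of_one_le hx.2.1.le]
        exact hδγ j _ (hdirS x hx.2.1)
  -- `U₃` is the old set at low height. `U₁ j` is the thickened cell at large height, with no
  -- condition on the old coordinates. The collar `U₂ j` has no condition on the height and joins
  -- the two along the attaching sphere.
  set W' : Set (ModelSpace J) := U₃ ∪ ⋃ j, (U₁ j ∪ U₂ j) with hW'
  have hsub₁ : ∀ j, U₁ j ⊆ W' := fun j x hx => Or.inr (mem_iUnion.2 ⟨j, Or.inl hx⟩)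
  have hsub₂ : ∀ j, U₂ j ⊆ W' := fun j x hx => Or.inr (mem_iUnion.2 ⟨j, Or.inr hx⟩)
  have hat : ∀ (U : Set (ModelSpace J)) (g : ModelSpace J → K), IsOpen U → (∀ x ∈ U, r' x = g x) →
      ContinuousOn g U → ∀ x ∈ U, ContinuousAt r' x := fun U g hU hg hgc x hx =>
    (hgc.congr hg).continuousAt (hU.mem_nhds hx)
  have hcoord : ∀ x : ModelSpace J, coord n (trunc (n + 1) x) = coord n x := fun x => by
    rw [trunc_apply, if_pos (Nat.lt_succ_self n)]
  have htt : ∀ x : ModelSpace J, trunc n (trunc (n + 1) x) = trunc n x := fun x =>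
    trunc_of_le fun k hk => by rw [trunc_apply, if_pos (by omega)]
  have hposT : ∀ x : ModelSpace J, pos n (trunc (n + 1) x) = pos n x := fun x => by
    rw [pos, hcoord]; rfl
  have hheightT : ∀ x : ModelSpace J, height n (trunc (n + 1) x) = height n x := fun x => by
    rw [height, hcoord]; rfl
  have htagT : ∀ x : ModelSpace J, tag n (trunc (n + 1) x) = tag n x := fun x => by
    rw [tag, hcoord]; rfl
  have hWT : ∀ x : ModelSpace J, trunc (n + 1) x ∈ W ↔ x ∈ W := fun x => by
    rw [← hWt, htt, hWt]
  have hrT : ∀ x : ModelSpace J, r (trunc (n + 1) x) = r x := fun x => by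
    rw [← hrt, htt, hrt]
  refine ⟨W', r', hoU₃.union (isOpen_iUnion fun j => (hoU₁ j).union (hoU₂ j)), ?_, ?_, ?_, ?_, ?_⟩
  · refine continuousOn_of_forall_continuousAt ?_
    rintro x (hx | hx)
    · exact hat U₃ r hoU₃ hr'₃ (hr.mono fun x hx => hx.2) x hx
    obtain ⟨j, hx | hx⟩ := mem_iUnion.1 hx
    · refine hat (U₁ j) _ (hoU₁ j) (hr'₁ j) ?_ x hx
      refine (hδ j).comp (continuous_ballRetraction.comp (continuous_pos n)).continuousOn ?_
      intro x _
      rw [mem_closedBall, dist_zero_right]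
      exact norm_ballRetraction_le _
    · refine hat (U₂ j) _ (hoU₂ j) (hr'₂ j) ?_ x hx
      refine hr.comp ?_ ?_
      · have h1 : ContinuousOn (fun x => γ j (dir x)) (U₂ j) := (hγdir j).mono fun x hx => hx.2.1
        have h2 : Continuous lam := by simp only [hlam]; fun_prop
        exact (continuous_trunc n).continuousOn.add
          ((h2.comp (continuous_height n)).continuousOn.smul
            (h1.sub (continuous_trunc n).continuousOn))
      · intro x hx
        refine hεW j _ (hdirS x hx.2.1) ?_
        refine (convex_ball (γ j (dir x)) (ε j)).add_smul_sub_mem ?_ (mem_ball_self (hε0 j))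
          (hlam01 _)
        rw [mem_ball, dist_eq_norm]
        exact hx.2.2
  · intro x
    simp only [hW', hU₁, hU₂, hU₃, hdir, mem_union, mem_iUnion, mem_ofPred_eq, hposT, hheightT, htagT,
      hWT, htt]
  · intro x
    simp only [hr', hlerp, hdir, hposT, hheightT, htagT, hrT, htt]
  · exact fun x hx h => ⟨Or.inl ⟨h, hx⟩, hr'₃ x ⟨h, hx⟩⟩
  -- the lifts of the cells
  set a : ℝ → ℝ := fun ρ => max 0 (min 1 (6 * ρ - 3)) with ha
  set T : ℝ → ℝ := fun ρ => 3 * max 0 (min 1 (5 - 6 * ρ)) with hT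
  set b : ℝ → ℝ := fun ρ => min 1 (6 - 6 * ρ) with hb
  -- The lift changes one thing at a time. For `‖y‖` from `1/2` to `2/3` the old coordinates move
  -- from `0` to the attaching point, at height `3`; up to `5/6` the height falls to `0` along the
  -- collar; up to `1` the position and the tag fade out, at height `0`. The factor `4` keeps the
  -- position outside the unit ball while the collar is crossed.
  set g : J n → (Fin n → ℝ) → AttachCoord J n := fun j y =>
    ((4 * b ‖y‖) • y, T ‖y‖, b ‖y‖ • basisTag j) with hg
  set τ : J n → (Fin n → ℝ) → ModelSpace J := fun j y => if ‖y‖ ≤ 1 / 2 then incl n (g j y) else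
    a ‖y‖ • γ j (‖y‖⁻¹ • y) + incl n (g j y) with hτ
  have hgc : ∀ j, Continuous (g j) := by
    intro j
    simp only [hg, hb, hT]
    fun_prop
  have hnS : ∀ y : Fin n → ℝ, 0 < ‖y‖ → ‖y‖⁻¹ • y ∈ sphere (0 : Fin n → ℝ) 1 := fun y hy => by
    rw [mem_sphere, dist_zero_right]
    exact norm_normalize hy
  have hτ' : ∀ j y, 1 / 2 ≤ ‖y‖ → τ j y = a ‖y‖ • γ j (‖y‖⁻¹ • y) + incl n (g j y) := by
    intro j y hy
    simp only [hτ]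
    split_ifs with h
    · have h0 : a ‖y‖ = 0 := by
        simp only [ha]
        rw [max_eq_left]
        exact (min_le_right _ _).trans (by linarith)
      rw [h0, zero_smul, zero_add]
    · rfl
  have hγn : ∀ j, ∀ y ∈ sphere (0 : Fin n → ℝ) 1, ∀ k, n ≤ k → coord k (γ j y) = 0 := fun j y hy =>
    trunc_eq_self_iff.1 (hγt j y hy)
  have hτk : ∀ j y, ∀ k, n < k → coord k (τ j y) = 0 := by
    intro j y k hk
    rcases le_or_gt ‖y‖ (1 / 2) with h | h
    · simp only [hτ, if_pos h]
      exact coord_incl_ne n _ hk.ne'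
    · rw [hτ' j y h.le, coord_add, coord_smul,
        hγn j _ (hnS y (by linarith)) k hk.le, smul_zero, zero_add]
      exact coord_incl_ne n _ hk.ne'
  have hτn : ∀ j y, coord n (τ j y) = g j y := by
    intro j y
    rcases le_or_gt ‖y‖ (1 / 2) with h | h
    · simp only [hτ, if_pos h]
      exact coord_incl_self n _
    · rw [hτ' j y h.le, coord_add, coord_smul,
        hγn j _ (hnS y (by linarith)) n le_rfl, smul_zero, zero_add]
      exact coord_incl_self n _
  have hτt : ∀ j y, 2 / 3 ≤ ‖y‖ → trunc n (τ j y) = γ j (‖y‖⁻¹ • y) := by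
    intro j y hy
    have h1 : a ‖y‖ = 1 := by
      simp only [ha]
      rw [min_eq_left (by linarith), max_eq_right zero_le_one]
    rw [hτ' j y (by linarith), h1, one_smul, ← hγt j _ (hnS y (by linarith))]
    refine trunc_of_le fun k hk => ?_
    rw [coord_add, coord_incl_ne n _ hk.ne, add_zero, trunc_apply, if_pos hk]
  refine ⟨τ, fun j => ?_, fun j y hy => ?_, fun j y hy => ?_⟩
  · have hcov : closedBall (0 : Fin n → ℝ) 1 ⊆ {y | ‖y‖ ≤ 1 / 2} ∪ {y | 1 / 2 ≤ ‖y‖} := fun y _ =>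
      (le_total ‖y‖ (1 / 2) : _ ∨ _)
    refine ContinuousOn.mono (ContinuousOn.union_of_isClosed ?_ ?_
      (isClosed_le continuous_norm continuous_const)
      (isClosed_le continuous_const continuous_norm)) hcov
    · refine ((continuous_incl n).comp (hgc j)).continuousOn.congr fun y hy => ?_
      exact if_pos hy
    · refine ContinuousOn.congr ?_ fun y hy => hτ' j y hy
      have hac : Continuous a := by simp only [ha]; fun_prop
      refine ContinuousOn.add (ContinuousOn.smul (hac.comp continuous_norm).continuousOn ?_)
        ((continuous_incl n).comp (hgc j)).continuousOn
      refine (hγ j).comp (continuousOn_normalize.mono fun y hy => ?_) fun y hy => ?_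
      · have : 1 / 2 ≤ ‖y‖ := hy
        change 0 < ‖y‖
        linarith
      · have : 1 / 2 ≤ ‖y‖ := hy
        exact hnS y (by linarith)
  · rw [mem_closedBall, dist_zero_right] at hy
    have htr : trunc (n + 1) (τ j y) = τ j y := trunc_eq_self_iff.2 fun k hk => hτk j y k hk
    have hposτ : pos n (τ j y) = (4 * b ‖y‖) • y := by rw [pos, hτn]
    have hheightτ : height n (τ j y) = T ‖y‖ := by rw [height, hτn]
    have htagτ : tag n (τ j y) = b ‖y‖ • basisTag j := by rw [tag, hτn]
    have hb1 : ‖y‖ ≤ 5 / 6 → b ‖y‖ = 1 := fun h => by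
      simp only [hb]; exact min_eq_left (by linarith)
    have htag1 : ‖y‖ ≤ 5 / 6 → ‖tag n (τ j y) - basisTag j‖ < 1 / 2 := fun h => by
      rw [htagτ, hb1 h, one_smul, sub_self, norm_zero]; norm_num
    rcases le_or_gt ‖y‖ (2 / 3) with h1 | h1
    · have hT3 : T ‖y‖ = 3 := by
        simp only [hT]
        rw [min_eq_left (by linarith), max_eq_right zero_le_one, mul_one]
      have hmem : τ j y ∈ U₁ j := ⟨htag1 (by linarith), by rw [hheightτ, hT3]; norm_num⟩
      refine ⟨hsub₁ j hmem, htr, ?_⟩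
      rw [hr'₁ j _ hmem, hposτ, hb1 (by linarith), mul_one]
    have hret : ballRetraction ((4 : ℝ) • y) = ‖y‖⁻¹ • y := by
      rw [ballRetraction_of_one_le, normalize_smul (by norm_num)]
      rw [norm_smul]
      norm_num
      linarith
    rw [hret, hδγ j _ (hnS y (by linarith))]
    rcases le_or_gt ‖y‖ (5 / 6) with h2 | h2
    · have hpos4 : pos n (τ j y) = (4 : ℝ) • y := by rw [hposτ, hb1 h2, mul_one]
      have hdir4 : dir (τ j y) = ‖y‖⁻¹ • y := by
        simp only [hdir]
        rw [hpos4, normalize_smul (by norm_num)]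
      have hmem : τ j y ∈ U₂ j := by
        refine ⟨htag1 h2, ?_, ?_⟩
        · rw [hpos4, norm_smul]
          norm_num
          linarith
        · rw [hdir4, hτt j y h1.le, sub_self, norm_zero]
          exact hε0 j
      refine ⟨hsub₂ j hmem, htr, ?_⟩
      rw [hr'₂ j _ hmem]
      simp only [hlerp]
      rw [hdir4, hτt j y h1.le, sub_self, smul_zero, add_zero]
    · have hT0 : T ‖y‖ = 0 := by
        simp only [hT]
        rw [max_eq_left, mul_zero]
        exact (min_le_right _ _).trans (by linarith)
      have hmem : τ j y ∈ U₃ := by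
        refine ⟨by rw [hheightτ, hT0]; norm_num, ?_⟩
        rw [← hWt, hτt j y h1.le]
        exact hγW j _ (hnS y (by linarith))
      refine ⟨Or.inl hmem, htr, ?_⟩
      rw [hr'₃ _ hmem, ← hrt, hτt j y h1.le]
  · rw [mem_sphere, dist_zero_right] at hy
    have h1 : a ‖y‖ = 1 := by
      simp only [ha]
      rw [hy, min_eq_left (by norm_num), max_eq_right zero_le_one]
    have h2 : g j y = 0 := by
      simp only [hg, hb, hT, hy]
      norm_num
      rfl
    rw [hτ' j y (by rw [hy]; norm_num), h1, h2, incl_zero, hy, inv_one, one_smul, one_smul, add_zero]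

/-! ### Maps defined on the skeleta of a CW complex -/

section Skeleta

open Topology.RelCWComplex

variable {K : Type u} [TopologicalSpace K] [Topology.CWComplex (univ : Set K)]

theorem map_inj {n : ℕ} {j k : cell (univ : Set K) n} {y z : Fin n → ℝ}
    (hy : y ∈ ball (0 : Fin n → ℝ) 1) (hz : z ∈ ball (0 : Fin n → ℝ) 1)
    (h : map n j y = map n k z) : j = k ∧ y = z := by
  have hjk : j = k := by
    by_contra hne
    have h1 : (⟨n, j⟩ : Σ n, cell (univ : Set K) n) ≠ ⟨n, k⟩ := fun h => hne (by simpa using h)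
    exact Set.disjoint_left.1 (disjoint_openCell_of_ne h1) (mem_image_of_mem _ hy)
      (h ▸ mem_image_of_mem _ hz)
  subst hjk
  refine ⟨rfl, (map n j).injOn ?_ ?_ h⟩
  · rwa [source_eq]
  · rwa [source_eq]

variable [T2Space K]

/-- The union of the open cells of dimension less than `n`. -/
abbrev skel (K : Type u) [TopologicalSpace K] [T2Space K] [Topology.CWComplex (univ : Set K)]
    (n : ℕ) : Set K := (skeletonLT (univ : Set K) (n : ℕ∞) : Set K)

theorem skel_mono {m n : ℕ} (h : m ≤ n) : skel K m ⊆ skel K n :=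
  skeletonLT_mono (C := (univ : Set K)) (by exact_mod_cast h)

theorem isClosed_skel (n : ℕ) : IsClosed (skel K n) := Subcomplex.closed _

theorem skel_zero : skel K 0 = ∅ := Topology.CWComplex.skeletonLT_zero_eq_empty

theorem iUnion_skel : ⋃ n, skel K n = univ := iUnion_skeletonLT_eq_complex

theorem map_mem_skel_of_sphere {n : ℕ} (j : cell (univ : Set K) n) {y : Fin n → ℝ}
    (hy : y ∈ sphere (0 : Fin n → ℝ) 1) : map n j y ∈ skel K n :=
  cellFrontier_subset_skeletonLT n j (mem_image_of_mem _ hy)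

theorem map_mem_skel_succ {n : ℕ} (j : cell (univ : Set K) n) {y : Fin n → ℝ}
    (hy : y ∈ closedBall (0 : Fin n → ℝ) 1) : map n j y ∈ skel K (n + 1) := by
  have := closedCell_subset_skeletonLT n j (mem_image_of_mem _ hy)
  exact_mod_cast this

theorem map_notMem_skel {n : ℕ} (j : cell (univ : Set K) n) {y : Fin n → ℝ}
    (hy : y ∈ ball (0 : Fin n → ℝ) 1) : map n j y ∉ skel K n := fun h =>
  Set.disjoint_left.1 (disjoint_skeletonLT_openCell (C := (univ : Set K)) (n := (n : ℕ∞)) le_rfl) h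
    (mem_image_of_mem _ hy)

theorem mem_skel_succ {n : ℕ} {x : K} (hx : x ∈ skel K (n + 1)) :
    x ∈ skel K n ∨ ∃ (j : cell (univ : Set K) n), ∃ y ∈ ball (0 : Fin n → ℝ) 1, map n j y = x := by
  obtain ⟨m, hm, j, hj⟩ := Topology.CWComplex.mem_skeletonLT_iff.1 hx
  have hm' : m < n + 1 := by exact_mod_cast hm
  rcases Nat.lt_succ_iff_lt_or_eq.1 hm' with h | rfl
  · exact Or.inl (Topology.CWComplex.mem_skeletonLT_iff.2 ⟨m, by exact_mod_cast h, j, hj⟩)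
  · exact Or.inr ⟨j, hj⟩

/-- The preimage of a closed set is tested on cells: cells of dimension below `n` lie in the old
skeleton, on an `n`-cell the preimage is the image of a compact set, and open cells of higher
dimension are disjoint from the skeleton. -/
theorem continuousOn_skel_succ {Z : Type*} [TopologicalSpace Z] {n : ℕ} {f : K → Z}
    (hf : ContinuousOn f (skel K n))
    (hc : ∀ j : cell (univ : Set K) n, ContinuousOn (fun y => f (map n j y)) (closedBall 0 1)) :
    ContinuousOn f (skel K (n + 1)) := by
  rw [continuousOn_iff_isClosed]
  intro t ht
  refine ⟨f ⁻¹' t ∩ skel K (n + 1), ?_, by rw [inter_assoc, inter_self]⟩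
  refine Topology.CWComplex.isClosed_of_disjoint_openCell_or_isClosed_inter_closedCell
    (subset_univ _) fun m _ j => ?_
  rcases lt_trichotomy m n with h | rfl | h
  · right
    have hsub : closedCell m j ⊆ skel K n :=
      Subset.trans (by
        have := closedCell_subset_skeletonLT m j
        exact_mod_cast this) (skel_mono (Nat.succ_le_of_lt h))
    have h1 : f ⁻¹' t ∩ skel K (n + 1) ∩ closedCell m j = skel K n ∩ f ⁻¹' t ∩ closedCell m j := by
      ext x
      simp only [mem_inter_iff]
      constructor
      · rintro ⟨⟨h1, _⟩, h3⟩
        exact ⟨⟨hsub h3, h1⟩, h3⟩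
      · rintro ⟨⟨h1, h2⟩, h3⟩
        exact ⟨⟨h2, skel_mono (Nat.le_succ n) h1⟩, h3⟩
    rw [h1]
    exact (hf.preimage_isClosed_of_isClosed (isClosed_skel n) ht).inter isClosed_closedCell
  · right
    have h1 : f ⁻¹' t ∩ skel K (m + 1) ∩ closedCell m j =
        map m j '' (closedBall 0 1 ∩ (fun y => f (map m j y)) ⁻¹' t) := by
      ext x
      constructor
      · rintro ⟨⟨h1, _⟩, y, hy, rfl⟩
        exact ⟨y, ⟨hy, h1⟩, rfl⟩
      · rintro ⟨y, ⟨hy, h1⟩, rfl⟩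
        exact ⟨⟨h1, map_mem_skel_succ j hy⟩, mem_image_of_mem _ hy⟩
    rw [h1]
    refine IsCompact.isClosed (IsCompact.image_of_continuousOn ?_
      ((Topology.RelCWComplex.continuousOn m j).mono inter_subset_left))
    exact (isCompact_closedBall 0 1).of_isClosed_subset
      ((hc j).preimage_isClosed_of_isClosed isClosed_closedBall ht) inter_subset_left
  · left
    refine Disjoint.mono_left inter_subset_right ?_
    exact disjoint_skeletonLT_openCell (C := (univ : Set K)) (n := ((n + 1 : ℕ) : ℕ∞))
      (by exact_mod_cast h)

/-- Closedness is tested on closed cells, and each of these lies in some skeleton. -/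
theorem continuous_of_continuousOn_skel {Z : Type*} [TopologicalSpace Z] {f : K → Z}
    (hf : ∀ n, ContinuousOn f (skel K n)) : Continuous f := by
  rw [continuous_iff_isClosed]
  intro t ht
  rw [Topology.CWComplex.closed (univ : Set K) _ (subset_univ _)]
  intro n j
  have hsub : closedCell n j ⊆ skel K (n + 1) := by
    have := closedCell_subset_skeletonLT n j
    exact_mod_cast this
  have h1 : f ⁻¹' t ∩ closedCell n j = skel K (n + 1) ∩ f ⁻¹' t ∩ closedCell n j := by
    ext x
    simp only [mem_inter_iff]
    constructor
    · rintro ⟨h1, h3⟩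
      exact ⟨⟨hsub h3, h1⟩, h3⟩
    · rintro ⟨⟨h1, h2⟩, h3⟩
      exact ⟨h2, h3⟩
  rw [h1]
  exact ((hf (n + 1)).preimage_isClosed_of_isClosed (isClosed_skel _) ht).inter isClosed_closedCell

/-- A map on a skeleton extends over the next skeleton by prescribing it on the cells. -/
theorem exists_extension_skel_succ {Z : Type*} [TopologicalSpace Z] {n : ℕ} (σ : K → Z)
    (hσ : ContinuousOn σ (skel K n)) (τ : cell (univ : Set K) n → (Fin n → ℝ) → Z)
    (hτ : ∀ j, ContinuousOn (τ j) (closedBall 0 1))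
    (hστ : ∀ j, ∀ y ∈ sphere (0 : Fin n → ℝ) 1, τ j y = σ (map n j y)) :
    ∃ σ' : K → Z, EqOn σ' σ (skel K n) ∧
      (∀ j, ∀ y ∈ closedBall (0 : Fin n → ℝ) 1, σ' (map n j y) = τ j y) ∧
      ContinuousOn σ' (skel K (n + 1)) := by
  classical
  let P : K → cell (univ : Set K) n × (Fin n → ℝ) → Prop := fun x p =>
    p.2 ∈ ball (0 : Fin n → ℝ) 1 ∧ map n p.1 p.2 = x
  let σ' : K → Z := fun x => if x ∈ skel K n then σ x else
    if h : ∃ p, P x p then τ h.choose.1 h.choose.2 else σ x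
  have h1 : EqOn σ' σ (skel K n) := fun x hx => if_pos hx
  have h2 : ∀ j, ∀ y ∈ closedBall (0 : Fin n → ℝ) 1, σ' (map n j y) = τ j y := by
    intro j y hy
    rw [mem_closedBall, dist_zero_right] at hy
    rcases hy.lt_or_eq with hlt | heq
    · have hyb : y ∈ ball (0 : Fin n → ℝ) 1 := by rwa [mem_ball, dist_zero_right]
      have hex : ∃ p, P (map n j y) p := ⟨(j, y), hyb, rfl⟩
      have h3 := hex.choose_spec
      obtain ⟨h4, h5⟩ := map_inj h3.1 hyb h3.2
      simp only [σ', if_neg (map_notMem_skel j hyb), dif_pos hex, h4, h5]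
    · have hys : y ∈ sphere (0 : Fin n → ℝ) 1 := by rwa [mem_sphere, dist_zero_right]
      rw [h1 (map_mem_skel_of_sphere j hys), hστ j y hys]
  exact ⟨σ', h1, h2, continuousOn_skel_succ (hσ.congr h1) fun j => (hτ j).congr (h2 j)⟩

end Skeleta

/-! ### Domination of a CW complex by an open subset of a normed space -/

/-- Currying a map that is continuous over a subset. -/
theorem exists_curry_continuousOn {Y K : Type*} [TopologicalSpace Y] [TopologicalSpace K]
    [Nonempty K] {s : Set Y} (G : Y → unitInterval → K)
    (hG : ContinuousOn (fun p : Y × unitInterval => G p.1 p.2) (s ×ˢ univ)) :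
    ∃ Γ : Y → C(unitInterval, K), ContinuousOn Γ s ∧ ∀ y ∈ s, ∀ t, Γ y t = G y t := by
  classical
  have hc : Continuous fun p : s × unitInterval => G p.1 p.2 :=
    hG.comp_continuous (f := fun p : s × unitInterval => ((p.1 : Y), p.2)) (by fun_prop)
      fun p => ⟨p.1.2, mem_univ _⟩
  let g : C(s, C(unitInterval, K)) := ContinuousMap.curry ⟨_, hc⟩
  refine ⟨fun y => if h : y ∈ s then g ⟨y, h⟩ else ContinuousMap.const _ (Classical.arbitrary K),
    ?_, fun y hy t => ?_⟩
  · rw [continuousOn_iff_continuous_domRestrict]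
    refine g.continuous.congr fun y => ?_
    simp
  · simp only [dif_pos hy]
    rfl

section OpenModel

open Topology.RelCWComplex

variable (K : Type u) [TopologicalSpace K] [T2Space K] [Topology.CWComplex (univ : Set K)]

/-- The ambient space of the open model of `K`. -/
abbrev CellModel : Type u := ModelSpace fun n => cell (univ : Set K) n

/-- An open model of the union of the cells of dimension less than `n`: an open set `W` with a map
`r` to `K`, and a map `σ` recording for each point `x` of the skeleton a point of `W` and a path
from its image to `x`. -/
structure ModelStage (n : ℕ) where
  W : Set (CellModel K)
  r : CellModel K → K
  σ : K → CellModel K × C(unitInterval, K)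
  isOpen : IsOpen W
  r_cont : ContinuousOn r W
  trunc_mem : ∀ x, trunc n x ∈ W ↔ x ∈ W
  r_trunc : ∀ x, r (trunc n x) = r x
  σ_cont : ContinuousOn σ (skel K n)
  σ_mem : ∀ x ∈ skel K n, (σ x).1 ∈ W
  σ_trunc : ∀ x ∈ skel K n, trunc n (σ x).1 = (σ x).1
  path_zero : ∀ x ∈ skel K n, (σ x).2 0 = r (σ x).1
  path_one : ∀ x ∈ skel K n, (σ x).2 1 = x
  path_const : ∀ x ∈ skel K n, x ∈ skel K 1 → ∀ t, (σ x).2 t = x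

variable {K}

/-- Compatibility of consecutive stages. -/
def ModelStage.Extends {n : ℕ} (S : ModelStage K n) (S' : ModelStage K (n + 1)) : Prop :=
  (∀ x ∈ S.W, height n x < 1 → x ∈ S'.W ∧ S'.r x = S.r x) ∧ EqOn S'.σ S.σ (skel K n)

/-- On the boundary of a cell, `r ∘ σ` is only joined to the characteristic map by the stored paths.
The cell is therefore enlarged by a collar along which these paths are run backwards; the enlarged
cell has boundary values `r ∘ σ` and can be attached by `exists_attach`. -/
theorem ModelStage.exists_extends [Nonempty K] {n : ℕ} (S : ModelStage K n) :
    ∃ S' : ModelStage K (n + 1), S.Extends S' := by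
  classical
  have hφc : ∀ j : cell (univ : Set K) n, ContinuousOn (map n j) (closedBall 0 1) := fun j =>
    Topology.RelCWComplex.continuousOn n j
  have hσφ : ∀ j : cell (univ : Set K) n, ContinuousOn (fun y => S.σ (map n j y)) (sphere 0 1) :=
    fun j => S.σ_cont.comp ((hφc j).mono sphere_subset_closedBall)
      fun y hy => map_mem_skel_of_sphere j hy
  set γ : cell (univ : Set K) n → (Fin n → ℝ) → CellModel K := fun j y => (S.σ (map n j y)).1
    with hγ
  -- At `‖z‖ = 1` the path is at its end, the boundary point of the cell; at `‖z‖ = 2` it is at its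
  -- start, the value of `r ∘ σ`.
  set M₂ : cell (univ : Set K) n → (Fin n → ℝ) → K := fun j z =>
    (S.σ (map n j (‖z‖⁻¹ • z))).2 (projIcc 0 1 zero_le_one (2 - ‖z‖)) with hM₂
  set M : cell (univ : Set K) n → (Fin n → ℝ) → K := fun j z =>
    if ‖z‖ ≤ 1 then map n j z else M₂ j z with hM
  have hnS : ∀ z : Fin n → ℝ, 0 < ‖z‖ → ‖z‖⁻¹ • z ∈ sphere (0 : Fin n → ℝ) 1 := fun z hz => by
    rw [mem_sphere, dist_zero_right]
    exact norm_normalize hz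
  have hM1 : ∀ j z, ‖z‖ ≤ 1 → M j z = map n j z := fun j z hz => if_pos hz
  have hM2 : ∀ j z, 1 ≤ ‖z‖ → M j z = M₂ j z := by
    intro j z hz
    rcases hz.lt_or_eq with h | h
    · exact if_neg (not_le.2 h)
    · rw [hM1 j z h.symm.le]
      have hzs : z ∈ sphere (0 : Fin n → ℝ) 1 := by rw [mem_sphere, dist_zero_right, h]
      have h1 : projIcc (0 : ℝ) 1 zero_le_one (2 - ‖z‖) = 1 := by
        rw [← h]
        norm_num
      simp only [hM₂]
      rw [h1, ← h, inv_one, one_smul, S.path_one _ (map_mem_skel_of_sphere j hzs)]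
  have hMc : ∀ j, Continuous (M j) := by
    intro j
    have h1 : ContinuousOn (M j) {z | ‖z‖ ≤ 1} := by
      refine ((hφc j).mono fun z hz => ?_).congr fun z hz => hM1 j z hz
      rw [mem_closedBall, dist_zero_right]
      exact hz
    have h2 : ContinuousOn (M j) {z | 1 ≤ ‖z‖} := by
      refine ContinuousOn.congr ?_ fun z hz => hM2 j z hz
      have hpos : ∀ z ∈ {z : Fin n → ℝ | 1 ≤ ‖z‖}, 0 < ‖z‖ := fun z hz => by
        have : 1 ≤ ‖z‖ := hz
        linarith
      have h3 : ContinuousOn (fun z : Fin n → ℝ => S.σ (map n j (‖z‖⁻¹ • z))) {z | 1 ≤ ‖z‖} :=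
        (hσφ j).comp (continuousOn_normalize.mono hpos) fun z hz => hnS z (hpos z hz)
      have h4 : Continuous fun z : Fin n → ℝ => projIcc (0 : ℝ) 1 zero_le_one (2 - ‖z‖) :=
        continuous_projIcc.comp (by fun_prop)
      exact ContinuousOn.eval h3.snd h4.continuousOn
    have h3 := h1.union_of_isClosed h2 (isClosed_le continuous_norm continuous_const)
      (isClosed_le continuous_const continuous_norm)
    rw [← continuousOn_univ]
    exact h3.mono fun z _ => (le_total ‖z‖ 1 : _ ∨ _)
  set δ : cell (univ : Set K) n → (Fin n → ℝ) → K := fun j z => M j ((2 : ℝ) • z) with hδ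
  have hδγ : ∀ j, ∀ y ∈ sphere (0 : Fin n → ℝ) 1, δ j y = S.r (γ j y) := by
    intro j y hy
    have hy1 : ‖y‖ = 1 := by rwa [mem_sphere, dist_zero_right] at hy
    have h2 : ‖(2 : ℝ) • y‖ = 2 := by rw [norm_smul, hy1]; norm_num
    simp only [hδ]
    rw [hM2 j _ (by rw [h2]; norm_num)]
    simp only [hM₂]
    rw [normalize_smul two_pos, h2, hy1, inv_one, one_smul, sub_self, projIcc_left]
    exact S.path_zero _ (map_mem_skel_of_sphere j hy)
  obtain ⟨W', r', hW', hr', hWt', hrt', hext, τ, hτc, hτ, hτγ⟩ := exists_attach n S.W S.r S.isOpen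
    S.r_cont S.trunc_mem S.r_trunc γ (fun j => (hσφ j).fst)
    (fun j y hy => S.σ_mem _ (map_mem_skel_of_sphere j hy))
    (fun j y hy => S.σ_trunc _ (map_mem_skel_of_sphere j hy)) δ
    (fun j => ((hMc j).comp (by fun_prop)).continuousOn) hδγ
  -- The new paths are images under `M j` of straight segments in `ℝⁿ`. For `‖y‖ = 1` the segment is
  -- `(2 - t) • y`, and its image is the path already stored at that boundary point.
  have hG : ∀ j : cell (univ : Set K) n, ∃ Γ : (Fin n → ℝ) → C(unitInterval, K),
      ContinuousOn Γ (closedBall 0 1) ∧ ∀ y ∈ closedBall (0 : Fin n → ℝ) 1, ∀ t : unitInterval,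
        Γ y t = M j ((1 - (t : ℝ)) • ((2 : ℝ) • ballRetraction ((4 : ℝ) • y)) + (t : ℝ) • y) := by
    intro j
    refine exists_curry_continuousOn _ (Continuous.continuousOn ((hMc j).comp ?_))
    have := continuous_ballRetraction (E := Fin n → ℝ)
    fun_prop
  choose Γ hΓc hΓ using hG
  have hσn : ∀ x ∈ skel K n, ∀ k, n ≤ k → coord k (S.σ x).1 = 0 := fun x hx =>
    trunc_eq_self_iff.1 (S.σ_trunc x hx)
  obtain ⟨σ', hσ'1, hσ'2, hσ'c⟩ := exists_extension_skel_succ S.σ S.σ_cont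
    (fun j y => (τ j y, Γ j y)) (fun j => (hτc j).prodMk (hΓc j)) (by
      intro j y hy
      have hy1 : ‖y‖ = 1 := by rwa [mem_sphere, dist_zero_right] at hy
      refine Prod.ext (hτγ j y hy) (ContinuousMap.ext fun t => ?_)
      have hret : ballRetraction ((4 : ℝ) • y) = y := by
        rw [ballRetraction_of_one_le, normalize_smul (by norm_num), hy1, inv_one, one_smul]
        rw [norm_smul, hy1]
        norm_num
      have ht : (1 - (t : ℝ)) • ((2 : ℝ) • y) + (t : ℝ) • y = (2 - (t : ℝ)) • y := by
        rw [smul_smul, ← add_smul]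
        congr 1
        ring
      have hpos : 0 < 2 - (t : ℝ) := by linarith [t.2.2]
      have hn : ‖(2 - (t : ℝ)) • y‖ = 2 - (t : ℝ) := by
        rw [norm_smul, hy1, mul_one, Real.norm_of_nonneg hpos.le]
      change Γ j y t = (S.σ (map n j y)).2 t
      rw [hΓ j y (sphere_subset_closedBall hy), hret, ht, hM2 j _ (by rw [hn]; linarith [t.2.2])]
      simp only [hM₂]
      rw [normalize_smul hpos, hy1, inv_one, one_smul, hn, sub_sub_cancel, projIcc_val])
  have hold : ∀ x ∈ skel K n, (σ' x).1 ∈ W' ∧ r' (σ' x).1 = S.r (S.σ x).1 := by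
    intro x hx
    rw [hσ'1 hx]
    refine hext _ (S.σ_mem x hx) ?_
    rw [height, hσn x hx n le_rfl]
    exact zero_lt_one
  refine ⟨⟨W', r', σ', hW', hr', hWt', hrt', hσ'c, ?_, ?_, ?_, ?_, ?_⟩,
    fun x hx h => hext x hx h, hσ'1⟩
  · intro x hx
    rcases mem_skel_succ hx with h | ⟨j, y, hy, rfl⟩
    · exact (hold x h).1
    · rw [hσ'2 j y (ball_subset_closedBall hy)]
      exact (hτ j y (ball_subset_closedBall hy)).1
  · intro x hx
    rcases mem_skel_succ hx with h | ⟨j, y, hy, rfl⟩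
    · rw [hσ'1 h]
      exact trunc_eq_self_iff.2 fun k hk => hσn x h k (by omega)
    · rw [hσ'2 j y (ball_subset_closedBall hy)]
      exact (hτ j y (ball_subset_closedBall hy)).2.1
  · intro x hx
    rcases mem_skel_succ hx with h | ⟨j, y, hy, rfl⟩
    · rw [(hold x h).2, hσ'1 h]
      exact S.path_zero x h
    · rw [hσ'2 j y (ball_subset_closedBall hy), (hτ j y (ball_subset_closedBall hy)).2.2]
      change Γ j y 0 = _
      rw [hΓ j y (ball_subset_closedBall hy)]
      simp [hδ]
  · intro x hx
    rcases mem_skel_succ hx with h | ⟨j, y, hy, rfl⟩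
    · rw [hσ'1 h]
      exact S.path_one x h
    · have hyc := ball_subset_closedBall hy
      rw [hσ'2 j y hyc]
      change Γ j y 1 = _
      rw [mem_closedBall, dist_zero_right] at hyc
      rw [hΓ j y (ball_subset_closedBall hy), ← hM1 j y hyc]
      simp
  · intro x hx hx1 t
    rcases mem_skel_succ hx with h | ⟨j, y, hy, rfl⟩
    · rw [hσ'1 h]
      exact S.path_const x h hx1 t
    -- Only vertices are concerned, and in `ℝ⁰` every segment is constant.
    · have hn : n = 0 := by
        by_contra hn
        exact map_notMem_skel j hy (skel_mono (by omega) hx1)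
      subst hn
      have hyc := ball_subset_closedBall hy
      rw [hσ'2 j y hyc]
      change Γ j y t = _
      rw [mem_closedBall, dist_zero_right] at hyc
      rw [hΓ j y (ball_subset_closedBall hy), ← hM1 j y hyc]
      exact congrArg _ (Subsingleton.elim _ _)

/-- A Hausdorff CW complex is dominated, relative to a vertex, by an open subset of a normed
space. -/
theorem exists_open_model (pt : K) (hpt : pt ∈ skel K 1) :
    ∃ W : Set (CellModel K), IsOpen W ∧ ∃ (s : C(K, W)) (r : C(W, K)),
      (r.comp s).HomotopicRel (ContinuousMap.id K) {pt} := by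
  classical
  have : Nonempty K := ⟨pt⟩
  have h0 : ∀ x : K, x ∉ skel K 0 := fun x => by rw [skel_zero]; exact id
  let S₀ : ModelStage K 0 :=
    { W := ∅
      r := fun _ => pt
      σ := fun _ => (0, ContinuousMap.const _ pt)
      isOpen := isOpen_empty
      r_cont := continuousOn_empty _
      trunc_mem := fun _ => Iff.rfl
      r_trunc := fun _ => rfl
      σ_cont := continuousOn_const
      σ_mem := fun x hx => absurd hx (h0 x)
      σ_trunc := fun x hx => absurd hx (h0 x)
      path_zero := fun x hx => absurd hx (h0 x)
      path_one := fun x hx => absurd hx (h0 x)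
      path_const := fun x hx => absurd hx (h0 x) }
  choose next hnext using fun (n : ℕ) (S : ModelStage K n) => S.exists_extends
  let S : ∀ n, ModelStage K n := fun n => Nat.rec S₀ next n
  have hS : ∀ n, (S n).Extends (S (n + 1)) := fun n => hnext n (S n)
  have hσ : ∀ n m, n ≤ m → EqOn (S m).σ (S n).σ (skel K n) := by
    intro n m hnm
    induction m, hnm using Nat.le_induction with
    | base => exact fun _ _ => rfl
    | succ m hnm ih => exact fun x hx => ((hS m).2 (skel_mono hnm hx)).trans (ih hx)
  have hr : ∀ n m, n ≤ m → ∀ x ∈ (S n).W, (∀ k, n ≤ k → height k x < 1) →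
      x ∈ (S m).W ∧ (S m).r x = (S n).r x := by
    intro n m hnm x hx hk
    induction m, hnm using Nat.le_induction with
    | base => exact ⟨hx, rfl⟩
    | succ m hnm ih =>
      obtain ⟨h1, h2⟩ := (hS m).1 x ih.1 (hk m hnm)
      exact ⟨h1, h2.trans ih.2⟩
  -- the limit of the open sets
  let P : ℕ → CellModel K → Prop := fun n x =>
    x ∈ (S n).W ∧ ∃ ε > 0, ∀ k, n ≤ k → height k x ≤ 1 - ε
  have hPlt : ∀ n x, P n x → ∀ k, n ≤ k → height k x < 1 := by
    rintro n x ⟨-, ε, hε, h⟩ k hk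
    linarith [h k hk]
  -- Infinitely many heights must stay below `1` at once; the uniform margin `ε` makes this an open
  -- condition.
  have hPo : ∀ n, IsOpen {x | P n x} := by
    intro n
    rw [Metric.isOpen_iff]
    rintro x ⟨hx, ε, hε, h⟩
    obtain ⟨η, hη, hball⟩ := Metric.isOpen_iff.1 (S n).isOpen x hx
    refine ⟨min η (ε / 2), lt_min hη (by linarith), fun y hy => ?_⟩
    rw [mem_ball] at hy
    refine ⟨hball (mem_ball.2 (hy.trans_le (min_le_left _ _))), ε / 2, by linarith, fun k hk => ?_⟩
    have h1 := abs_height_sub_le k y x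
    rw [← dist_eq_norm] at h1
    have h2 := le_abs_self (height k y - height k x)
    have h3 := hy.trans_le (min_le_right _ _)
    linarith [h k hk]
  let W : Set (CellModel K) := ⋃ n, {x | P n x}
  let r : CellModel K → K := fun x => if h : ∃ n, P n x then (S h.choose).r x else pt
  have hrP : ∀ n x, P n x → r x = (S n).r x := by
    intro n x hx
    have hex : ∃ n, P n x := ⟨n, hx⟩
    have h1 : r x = (S hex.choose).r x := dif_pos hex
    have h2 := hr hex.choose (max hex.choose n) (le_max_left _ _) x hex.choose_spec.1
      (hPlt _ _ hex.choose_spec)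
    have h3 := hr n (max hex.choose n) (le_max_right _ _) x hx.1 (hPlt _ _ hx)
    rw [h1, ← h2.2, h3.2]
  have hrc : ContinuousOn r W := by
    refine continuousOn_of_forall_continuousAt fun x hx => ?_
    obtain ⟨n, hn⟩ := mem_iUnion.1 hx
    exact (((S n).r_cont.mono fun y hy => hy.1).congr fun y hy => hrP n y hy).continuousAt
      ((hPo n).mem_nhds hn)
  -- the limit of the maps
  have hsk : ∀ x : K, ∃ n, x ∈ skel K n := fun x => by
    have : x ∈ ⋃ n, skel K n := by rw [iUnion_skel]; exact mem_univ x
    exact mem_iUnion.1 this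
  choose N hN using hsk
  let σ : K → CellModel K × C(unitInterval, K) := fun x => (S (N x)).σ x
  have hσn : ∀ n, EqOn σ (S n).σ (skel K n) := by
    intro n x hx
    have h1 := hσ (N x) (max (N x) n) (le_max_left _ _) (hN x)
    have h2 := hσ n (max (N x) n) (le_max_right _ _) hx
    exact h1.symm.trans h2
  have hσc : Continuous σ := continuous_of_continuousOn_skel fun n =>
    (S n).σ_cont.congr (hσn n)
  have hσP : ∀ n, ∀ x ∈ skel K n, P n (σ x).1 := by
    intro n x hx
    rw [hσn n hx]
    refine ⟨(S n).σ_mem x hx, 1, one_pos, fun k hk => ?_⟩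
    rw [height, trunc_eq_self_iff.1 ((S n).σ_trunc x hx) k hk, sub_self]
    exact le_rfl
  refine ⟨W, isOpen_iUnion hPo, ⟨fun x => ⟨(σ x).1, mem_iUnion.2 ⟨N x, hσP _ x (hN x)⟩⟩,
    hσc.fst.subtype_mk _⟩, ⟨fun w => r w, hrc.comp_continuous continuous_subtype_val fun w => w.2⟩,
    ⟨⟨⟨⟨fun p => (σ p.2).2 p.1, ?_⟩, ?_, ?_⟩, ?_⟩⟩⟩
  · exact Continuous.eval (hσc.snd.comp continuous_snd) continuous_fst
  · intro x
    change (σ x).2 0 = r (σ x).1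
    rw [hrP (N x) _ (hσP _ x (hN x)), hσn _ (hN x)]
    exact (S (N x)).path_zero x (hN x)
  · intro x
    change (σ x).2 1 = x
    rw [hσn _ (hN x)]
    exact (S (N x)).path_one x (hN x)
  · intro t x hx
    obtain rfl : x = pt := hx
    have h1 : (σ x).2 t = x := by
      rw [hσn 1 hpt]
      exact (S 1).path_const x hpt hpt t
    have h2 : r (σ x).1 = x := by
      rw [hrP 1 _ (hσP 1 x hpt), hσn 1 hpt, ← (S 1).path_zero x hpt]
      exact (S 1).path_const x hpt hpt 0
    exact h1.trans h2.symm

end OpenModel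

/-! ### `Σ`-trivial maps contract families of loops -/

theorem ContinuousMap.HomotopicRel.precomp {A B C : Type*} [TopologicalSpace A]
    [TopologicalSpace B] [TopologicalSpace C] {f g : C(B, C)} {S : Set B}
    (h : f.HomotopicRel g S) (k : C(A, B)) {T : Set A} (hT : MapsTo k T S) :
    (f.comp k).HomotopicRel (g.comp k) T := by
  obtain ⟨F⟩ := h
  refine ⟨⟨⟨⟨fun p => F (p.1, k p.2), by fun_prop⟩, ?_, ?_⟩, ?_⟩⟩
  · intro a; simp
  · intro a; simp
  · intro t a ha
    exact F.eq_fst t (hT ha)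

/-- `X` is based-dominated by the open subset `W` of a normed space. -/
structure OpenDomination (X : BasedSpace.{u}) {H : Type u} [NormedAddCommGroup H]
    [NormedSpace ℝ H] (W : Set H) where
  isOpen : IsOpen W
  s : C(X, W)
  r : C(W, X)
  htpy : (r.comp s).HomotopicRel (ContinuousMap.id X) {X.pt}

namespace OpenDomination

variable {X : BasedSpace.{u}} {H : Type u} [NormedAddCommGroup H] [NormedSpace ℝ H] {W : Set H}

theorem r_s_pt (D : OpenDomination X W) : D.r (D.s X.pt) = X.pt := D.htpy.fst_eq_snd rfl

end OpenDomination

/-- The base point of the complex is a vertex, where the homotopy of `exists_open_model` is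
stationary; this keeps the composite with the homotopy equivalence based. -/
theorem BasedSpace.HasCWType.exists_openDomination {X : BasedSpace.{u}} (hX : X.HasCWType) :
    ∃ (H : Type u) (_ : NormedAddCommGroup H) (_ : NormedSpace ℝ H) (W : Set H),
      Nonempty (OpenDomination X W) := by
  obtain ⟨K, hT2, ⟨hCW, j, hj⟩, f, g, hgf, -⟩ := hX
  have hpt : K.pt ∈ skel K 1 := by
    have := Topology.RelCWComplex.closedCell_subset_skeletonLT 0 j hj
    exact_mod_cast this
  obtain ⟨W, hW, s, r, hrs⟩ := exists_open_model K.pt hpt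
  refine ⟨CellModel K, inferInstance, inferInstance, W,
    ⟨⟨hW, s.comp f.toMap, g.toMap.comp r, ?_⟩⟩⟩
  have h1 := (hrs.precomp f.toMap (T := {X.pt}) (by
    rintro x rfl
    exact f.map_pt)).comp_continuousMap g.toMap
  exact h1.trans hgf

/-- A map whose class is `Σ`-trivial kills every family of loops, relative to the end points. -/
theorem BasedSpace.comp_loops_homotopicRel_const {X : BasedSpace.{u}} {H : Type u}
    [NormedAddCommGroup H] [NormedSpace ℝ H] {W : Set H} (D : OpenDomination X W)
    {f : BasedSpace.Map X X} (hf : BasedSpace.HClass.mk f ∈ BasedSpace.Z BasedSpace.suspensions X)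
    {A : Type*} [TopologicalSpace A] (ω : C(A × unitInterval, X))
    (h0 : ∀ a, ω (a, 0) = X.pt) (h1 : ∀ a, ω (a, 1) = X.pt) :
    (f.toMap.comp ω).HomotopicRel (ContinuousMap.const _ X.pt) {p | p.2 = 0 ∨ p.2 = 1} := by
  let w₀ : H := D.s X.pt
  -- the space of loops
  let E : Submodule ℝ C(unitInterval, H) :=
    { carrier := {c | c 0 = 0 ∧ c 1 = 0}
      add_mem' := by
        rintro a b ⟨ha, ha'⟩ ⟨hb, hb'⟩
        exact ⟨by simp [ha, hb], by simp [ha', hb']⟩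
      zero_mem' := ⟨rfl, rfl⟩
      smul_mem' := by
        rintro c a ⟨ha, ha'⟩
        exact ⟨by simp [ha], by simp [ha']⟩ }
  -- Loops in `W` at `w₀`, translated so that the constant loop becomes `0`. The set is open because
  -- `[0,1]` is compact.
  let O : Set E := {c | ∀ t, w₀ + c.1 t ∈ W}
  have hO : IsOpen O := by
    have h2 : IsOpen {v : C(unitInterval, H) | MapsTo v univ W} :=
      ContinuousMap.isOpen_setOfPred_mapsTo isCompact_univ D.isOpen
    have h3 : Continuous fun c : E => ContinuousMap.const unitInterval w₀ + c.1 :=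
      continuous_const.add continuous_subtype_val
    have h4 : O = (fun c : E => ContinuousMap.const unitInterval w₀ + c.1) ⁻¹'
        {v : C(unitInterval, H) | MapsTo v univ W} := by
      ext c
      exact ⟨fun h t _ => h t, fun h t => h (mem_univ t)⟩
    rw [h4]
    exact h2.preimage h3
  have h0O : (0 : E) ∈ O := fun t => by simp [w₀]
  obtain ⟨N, hN, i, p, hp, ⟨G⟩⟩ := exists_cw_domination hO h0O
  let ev : C(O × unitInterval, W) := ⟨fun q => ⟨w₀ + q.1.1.1 q.2, q.1.2 q.2⟩, by
    refine Continuous.subtype_mk (continuous_const.add ?_) _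
    exact Continuous.eval (by fun_prop) continuous_snd⟩
  have hev : ∀ (c : O) (t : unitInterval), t = 0 ∨ t = 1 → ev (c, t) = D.s X.pt := by
    rintro c t (rfl | rfl)
    · refine Subtype.ext ?_
      change w₀ + c.1.1 0 = w₀
      rw [c.1.2.1, add_zero]
    · refine Subtype.ext ?_
      change w₀ + c.1.1 1 = w₀
      rw [c.1.2.2, add_zero]
  -- the adjoint of `ω`
  let ℓ : C(A, C(unitInterval, H)) := ContinuousMap.curry
    ⟨fun q : A × unitInterval => (D.s (ω q) : H) - w₀, by fun_prop⟩
  let lam : C(A, O) := ⟨fun a => ⟨⟨ℓ a, by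
      change (D.s (ω (a, 0)) : H) - w₀ = 0
      rw [h0, sub_self], by
      change (D.s (ω (a, 1)) : H) - w₀ = 0
      rw [h1, sub_self]⟩, fun t => by
      change w₀ + ((D.s (ω (a, t)) : H) - w₀) ∈ W
      rw [add_sub_cancel]
      exact (D.s (ω (a, t))).2⟩,
    (ℓ.continuous.subtype_mk _).subtype_mk _⟩
  have hlam : ∀ q : A × unitInterval, ev (lam q.1, q.2) = D.s (ω q) := fun q => by
    refine Subtype.ext ?_
    change w₀ + ((D.s (ω q) : H) - w₀) = _
    rw [add_sub_cancel]
  have hr0 : D.r (D.s X.pt) = X.pt := D.r_s_pt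
  let e : C(O × unitInterval, X) := D.r.comp ev
  let m₂ : C(A × unitInterval, X) := (f.toMap.comp e).comp (lam.prodMap (ContinuousMap.id _))
  let m₃ : C(A × unitInterval, X) :=
    (f.toMap.comp e).comp (((p.comp i).comp lam).prodMap (ContinuousMap.id _))
  -- from `f ∘ ω` to the loops in `W`
  have H1 : (f.toMap.comp ω).HomotopicRel m₂ {q | q.2 = 0 ∨ q.2 = 1} := by
    have h2 := (D.htpy.precomp ω (T := {q | q.2 = 0 ∨ q.2 = 1}) (by
      rintro ⟨a, t⟩ (ht | ht)
      · obtain rfl : t = 0 := ht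
        exact h0 a
      · obtain rfl : t = 1 := ht
        exact h1 a)).comp_continuousMap f.toMap
    have h3 : m₂ = f.toMap.comp ((D.r.comp D.s).comp ω) := by
      ext q
      exact congrArg (fun w => f.toMap (D.r w)) (hlam q)
    rw [h3]
    exact h2.symm
  -- deforming into the nerve
  have H2 : m₃.HomotopicRel m₂ {q | q.2 = 0 ∨ q.2 = 1} := by
    refine ⟨⟨⟨⟨fun q => f.toMap (e (G (q.1, lam q.2.1), q.2.2)), by fun_prop⟩, ?_, ?_⟩, ?_⟩⟩
    · intro q
      simp only [G.apply_zero]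
      rfl
    · intro q
      simp only [G.apply_one]
      rfl
    · intro t q hq
      exact congrArg (fun w => f.toMap (D.r w))
        ((hev (G (t, lam q.1)) q.2 hq).trans (hev (p (i (lam q.1))) q.2 hq).symm)
  -- the map on the suspension of the nerve
  let a : BasedSpace.Map (BasedSpace.suspension N) X :=
    ⟨⟨Quotient.lift (s := BasedSpace.suspensionSetoid N) (fun q => e (p q.1, q.2)) (by
        have hb : ∀ q : N × unitInterval, q.2 = 0 ∨ q.2 = 1 ∨ q.1 = N.pt →
            e (p q.1, q.2) = X.pt := by
          rintro ⟨n, t⟩ hq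
          change D.r (ev _) = X.pt
          rcases hq with hq | hq | hq
          · rw [hev _ _ (Or.inl hq), hr0]
          · rw [hev _ _ (Or.inr hq), hr0]
          -- The base point of `N` is sent to the constant loop, so the segment over it may be
          -- collapsed in the reduced suspension.
          · obtain rfl : n = N.pt := hq
            have : ev (p N.pt, t) = D.s X.pt := by
              rw [hp]
              refine Subtype.ext ?_
              change w₀ + (0 : C(unitInterval, H)) t = w₀
              simp
            rw [this, hr0]
        rintro q q' (rfl | ⟨hq, hq'⟩)
        · rfl
        · rw [hb q hq, hb q' hq']), by
        refine Continuous.quotient_lift ?_ _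
        fun_prop⟩, by
      change D.r (ev (p N.pt, 0)) = X.pt
      rw [hev _ _ (Or.inl rfl), hr0]⟩
  have hfa : BasedSpace.HClass.comp (BasedSpace.HClass.mk f) (BasedSpace.HClass.mk a) = 0 :=
    hf (BasedSpace.suspension N) ⟨N, hN, rfl⟩ (BasedSpace.HClass.mk a)
  have hfa' : (f.comp a).Homotopic (BasedSpace.Map.zero _ X) := Quotient.exact hfa
  let q : C(N × unitInterval, BasedSpace.suspension N) :=
    ⟨Quotient.mk (BasedSpace.suspensionSetoid N), continuous_quotient_mk'⟩
  have H3 : m₃.HomotopicRel (ContinuousMap.const _ X.pt) {q | q.2 = 0 ∨ q.2 = 1} := by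
    have h2 := hfa'.precomp (q.comp ((i.comp lam).prodMap (ContinuousMap.id unitInterval)))
      (T := {q | q.2 = 0 ∨ q.2 = 1}) (by
        rintro ⟨b, t⟩ ht
        refine Quotient.sound (s := BasedSpace.suspensionSetoid N) (Or.inr ⟨?_, Or.inl rfl⟩)
        rcases ht with ht | ht
        · exact Or.inl ht
        · exact Or.inr (Or.inl ht))
    exact h2
  exact H1.trans (H2.symm.trans H3)

/-! ### Merging two null-homotopies -/

/-- The map `G` is null-homotopic on `V`, by a homotopy (not fixing base points) to the constant
map at `x₀`. -/
def NullOn {Y X : Type*} [TopologicalSpace Y] [TopologicalSpace X] (G : Y → X) (x₀ : X)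
    (V : Set Y) : Prop :=
  ∃ h : Y → ℝ → X, ContinuousOn (fun p : Y × ℝ => h p.1 p.2) (V ×ˢ univ) ∧
    (∀ y ∈ V, h y 0 = G y) ∧ ∀ y ∈ V, h y 1 = x₀

theorem continuousOn_dite_subtype {Y T X : Type*} [TopologicalSpace Y] [TopologicalSpace T]
    [TopologicalSpace X] {s : Set Y} [∀ y, Decidable (y ∈ s)] {F : s × T → X} (hF : Continuous F)
    (x₀ : X) :
    ContinuousOn (fun p : Y × T => if h : p.1 ∈ s then F (⟨p.1, h⟩, p.2) else x₀) (s ×ˢ univ) := by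
  rw [continuousOn_iff_continuous_domRestrict]
  have h1 : Continuous fun p : (s ×ˢ (univ : Set T) : Set (Y × T)) =>
      F (⟨p.1.1, p.2.1⟩, p.1.2) := by
    refine hF.comp (Continuous.prodMk (Continuous.subtype_mk ?_ _) ?_) <;> fun_prop
  refine h1.congr fun p => ?_
  have : p.1.1 ∈ s := p.2.1
  simp [this]

/-- The two null-homotopies form loops over the overlap. `G` is first slid along them to the
position `ρ y`; then `f` contracts the loops with end points fixed, so this contraction extends by
the constant map beyond the overlap. -/
theorem NullOn.union {X : BasedSpace.{u}} {H : Type u}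
    [NormedAddCommGroup H] [NormedSpace ℝ H] {W : Set H} (D : OpenDomination X W)
    {f : BasedSpace.Map X X} (hf : BasedSpace.HClass.mk f ∈ BasedSpace.Z BasedSpace.suspensions X)
    {Y : Type*} [TopologicalSpace Y] {G : Y → X} {u v : Y → ℝ}
    (hu : Continuous u) (hv : Continuous v) (hu0 : ∀ y, 0 ≤ u y) (hv0 : ∀ y, 0 ≤ v y)
    (hGu : NullOn G X.pt {y | 0 < u y}) (hGv : NullOn G X.pt {y | 0 < v y}) :
    NullOn (fun y => f.toMap (G y)) X.pt {y | 0 < u y + v y} := by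
  classical
  obtain ⟨h₁, hc₁, h₁0, h₁1⟩ := hGu
  obtain ⟨h₂, hc₂, h₂0, h₂1⟩ := hGv
  set V : Set Y := {y | 0 < u y + v y} with hV
  set A : Set Y := {y | 0 < u y ∧ 0 < v y} with hA
  have hVo : IsOpen V := isOpen_lt continuous_const (hu.add hv)
  have hAo : IsOpen A := (isOpen_lt continuous_const hu).inter (isOpen_lt continuous_const hv)
  have hAV : A ⊆ V := fun y hy => add_pos hy.1 hy.2
  -- `V₁`, `V₂`: the parts of `V` where `u`, resp. `v`, dominates
  set V₁ : Set Y := {y | 2 * v y < u y} with hV₁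
  set V₂ : Set Y := {y | 2 * u y < v y} with hV₂
  have hV₁o : IsOpen V₁ := isOpen_lt (continuous_const.mul hv) hu
  have hV₂o : IsOpen V₂ := isOpen_lt (continuous_const.mul hu) hv
  have hu₁ : ∀ y ∈ V₁, 0 < u y := fun y hy => by
    have h3 : 2 * v y < u y := hy
    linarith [hv0 y]
  have hv₂ : ∀ y ∈ V₂, 0 < v y := fun y hy => by
    have h3 : 2 * u y < v y := hy
    linarith [hu0 y]
  have hcov : ∀ y ∈ V, y ∈ V₁ ∨ y ∈ V₂ ∨ y ∈ A := by
    intro y hy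
    by_cases h3 : 0 < u y
    · by_cases h4 : 0 < v y
      · exact Or.inr (Or.inr ⟨h3, h4⟩)
      · exact Or.inl (by change 2 * v y < u y; linarith)
    · refine Or.inr (Or.inl ?_)
      have h5 : 0 < u y + v y := hy
      change 2 * u y < v y
      linarith
  -- the position along the path
  set ρ : Y → ℝ := fun y => max 0 (min 1 (2 - 3 * (u y / (u y + v y)))) with hρ
  -- `V₁` and `V₂` are the sets where `u / (u + v)` is above `2/3`, respectively below `1/3`; `ρ`
  -- interpolates linearly in between.
  have hρ0 : ∀ y ∈ V₁, ρ y = 0 := by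
    intro y hy
    have h3 : 2 * v y < u y := hy
    have h4 := hu₁ y hy
    have h5 : 2 / 3 ≤ u y / (u y + v y) := by
      rw [div_le_div_iff₀ (by norm_num) (by linarith [hv0 y])]
      linarith
    simp only [hρ]
    exact max_eq_left ((min_le_right _ _).trans (by linarith))
  have hρ1 : ∀ y ∈ V₂, ρ y = 1 := by
    intro y hy
    have h3 : 2 * u y < v y := hy
    have h4 := hv₂ y hy
    have h5 : u y / (u y + v y) ≤ 1 / 3 := by
      rw [div_le_div_iff₀ (by linarith [hu0 y]) (by norm_num)]
      linarith
    simp only [hρ]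
    rw [min_eq_left (by linarith), max_eq_right zero_le_one]
  have hρI : ∀ y, ρ y ∈ Icc (0 : ℝ) 1 := fun y =>
    ⟨le_max_left _ _, max_le zero_le_one (min_le_left _ _)⟩
  have hρc : ContinuousOn ρ V := by
    have h3 : ContinuousOn (fun y => u y / (u y + v y)) V :=
      hu.continuousOn.div (hu.add hv).continuousOn fun y hy => ne_of_gt hy
    rw [hρ]
    refine ContinuousOn.sup continuousOn_const (ContinuousOn.inf continuousOn_const ?_)
    fun_prop
  -- the paths
  set q : Y → ℝ → X := fun y t => if t < 1 / 2 then h₁ y (1 - 2 * t) else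
    if t = 1 / 2 then G y else h₂ y (2 * t - 1) with hq
  have hq1 : ∀ y t, 0 < u y → t ≤ 1 / 2 → q y t = h₁ y (1 - 2 * t) := by
    intro y t hy ht
    rcases ht.lt_or_eq with h3 | h3
    · exact if_pos h3
    · subst h3
      have : (1 : ℝ) - 2 * (1 / 2) = 0 := by norm_num
      simp only [hq, lt_irrefl, if_false, if_true, this, h₁0 y hy]
  have hq2 : ∀ y t, 0 < v y → 1 / 2 ≤ t → q y t = h₂ y (2 * t - 1) := by
    intro y t hy ht
    rcases ht.lt_or_eq with h3 | h3
    · simp only [hq]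
      rw [if_neg (not_lt.2 ht), if_neg h3.ne']
    · subst h3
      have : 2 * (1 / 2) - (1 : ℝ) = 0 := by norm_num
      simp only [hq, lt_irrefl, if_false, if_true, this, h₂0 y hy]
  have hqG : ∀ y, q y (1 / 2) = G y := fun y => by simp [hq]
  have hqc : ContinuousOn (fun p : Y × ℝ => q p.1 p.2) (A ×ˢ univ) := by
    have h3 : ContinuousOn (fun p : Y × ℝ => q p.1 p.2) ((A ×ˢ univ) ∩ {p | p.2 ≤ 1 / 2}) := by
      refine ContinuousOn.congr (f := fun p : Y × ℝ => h₁ p.1 (1 - 2 * p.2)) ?_ ?_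
      · exact hc₁.comp (f := fun p : Y × ℝ => (p.1, 1 - 2 * p.2)) (by fun_prop)
          fun p hp => ⟨hp.1.1.1, mem_univ _⟩
      · exact fun p hp => hq1 _ _ hp.1.1.1 hp.2
    have h4 : ContinuousOn (fun p : Y × ℝ => q p.1 p.2) ((A ×ˢ univ) ∩ {p | 1 / 2 ≤ p.2}) := by
      refine ContinuousOn.congr (f := fun p : Y × ℝ => h₂ p.1 (2 * p.2 - 1)) ?_ ?_
      · exact hc₂.comp (f := fun p : Y × ℝ => (p.1, 2 * p.2 - 1)) (by fun_prop)
          fun p hp => ⟨hp.1.1.2, mem_univ _⟩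
      · exact fun p hp => hq2 _ _ hp.1.1.2 hp.2
    rintro ⟨y, t⟩ hp
    have h5 : (A ×ˢ (univ : Set ℝ)) = ((A ×ˢ univ) ∩ {p : Y × ℝ | p.2 ≤ 1 / 2}) ∪
        ((A ×ˢ univ) ∩ {p : Y × ℝ | 1 / 2 ≤ p.2}) := by
      rw [← inter_union_distrib_left, inter_eq_left.2]
      exact fun p _ => (le_total p.2 (1 / 2) : _ ∨ _)
    rw [h5]
    refine ContinuousWithinAt.union ?_ ?_
    · by_cases h6 : t ≤ 1 / 2
      · exact h3 _ ⟨hp, h6⟩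
      · refine continuousWithinAt_of_notMem_closure fun h7 => h6 ?_
        have h8 : IsClosed {p : Y × ℝ | p.2 ≤ 1 / 2} := isClosed_le continuous_snd continuous_const
        exact (h8.closure_subset_iff.2 inter_subset_right) h7
    · by_cases h6 : 1 / 2 ≤ t
      · exact h4 _ ⟨hp, h6⟩
      · refine continuousWithinAt_of_notMem_closure fun h7 => h6 ?_
        have h8 : IsClosed {p : Y × ℝ | 1 / 2 ≤ p.2} := isClosed_le continuous_const continuous_snd
        exact (h8.closure_subset_iff.2 inter_subset_right) h7
  -- the loops
  let ω : C(A × unitInterval, X) := ⟨fun p => q p.1 p.2, hqc.comp_continuous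
    (f := fun p : A × unitInterval => ((p.1 : Y), (p.2 : ℝ))) (by fun_prop)
    fun p => ⟨p.1.2, mem_univ _⟩⟩
  obtain ⟨F⟩ := BasedSpace.comp_loops_homotopicRel_const D hf ω
    (fun a => by
      change q a ((0 : unitInterval) : ℝ) = _
      rw [hq1 _ _ a.2.1 (by norm_num)]
      simpa using h₁1 a a.2.1)
    (fun a => by
      change q a ((1 : unitInterval) : ℝ) = _
      rw [hq2 _ _ a.2.2 (by norm_num)]
      have : 2 * ((1 : unitInterval) : ℝ) - 1 = 1 := by norm_num
      rw [this]
      exact h₂1 a a.2.2)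
  -- moving along the paths
  set e₁ : Y → ℝ → X := fun y τ => q y (1 / 2 + τ * (ρ y - 1 / 2)) with he₁
  -- Where `ρ` is `0` only the first half of the path is used, hence only `h₁`; where `ρ` is `1`,
  -- only `h₂`. So continuity persists where the other homotopy is not defined.
  have he₁c : ContinuousOn (fun p : Y × ℝ => e₁ p.1 p.2) (V ×ˢ Icc 0 1) := by
    have hloc : ∀ (U : Set Y) (g : Y × ℝ → X), IsOpen U → U ⊆ V →
        ContinuousOn g (U ×ˢ Icc 0 1) →
        (∀ p ∈ U ×ˢ Icc (0 : ℝ) 1, e₁ p.1 p.2 = g p) → ∀ p ∈ U ×ˢ Icc (0 : ℝ) 1,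
        ContinuousWithinAt (fun p : Y × ℝ => e₁ p.1 p.2) (V ×ˢ Icc 0 1) p := by
      intro U g hU hUV hg heq p hp
      have h3 : ContinuousWithinAt (fun p : Y × ℝ => e₁ p.1 p.2) (U ×ˢ Icc 0 1) p :=
        (hg p hp).congr heq (heq p hp)
      have h4 : (U ×ˢ Icc (0 : ℝ) 1) = (V ×ˢ Icc (0 : ℝ) 1) ∩ (U ×ˢ univ) := by
        rw [prod_inter_prod, inter_univ, inter_eq_right.2 hUV]
      rw [h4] at h3
      exact (continuousWithinAt_inter ((hU.prod isOpen_univ).mem_nhds ⟨hp.1, mem_univ _⟩)).1 h3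
    rintro ⟨y, τ⟩ ⟨hy, hτ⟩
    rcases hcov y hy with h3 | h3 | h3
    · refine hloc V₁ (fun p => h₁ p.1 p.2) hV₁o (fun z hz => ?_) ?_ ?_ _ ⟨h3, hτ⟩
      · exact add_pos_of_pos_of_nonneg (hu₁ z hz) (hv0 z)
      · exact hc₁.mono fun p hp => ⟨hu₁ _ hp.1, mem_univ _⟩
      · rintro ⟨z, t⟩ ⟨hz, ht⟩
        simp only [he₁]
        rw [hρ0 z hz, hq1 z _ (hu₁ z hz) (by linarith [ht.1])]
        congr 1
        ring
    · refine hloc V₂ (fun p => h₂ p.1 p.2) hV₂o (fun z hz => ?_) ?_ ?_ _ ⟨h3, hτ⟩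
      · exact add_pos_of_nonneg_of_pos (hu0 z) (hv₂ z hz)
      · exact hc₂.mono fun p hp => ⟨hv₂ _ hp.1, mem_univ _⟩
      · rintro ⟨z, t⟩ ⟨hz, ht⟩
        simp only [he₁]
        rw [hρ1 z hz, hq2 z _ (hv₂ z hz) (by linarith [ht.1])]
        congr 1
        ring
    · refine hloc A (fun p => e₁ p.1 p.2) hAo hAV ?_ (fun _ _ => rfl) _ ⟨h3, hτ⟩
      refine hqc.comp (f := fun p : Y × ℝ => (p.1, 1 / 2 + p.2 * (ρ p.1 - 1 / 2))) ?_
        fun p hp => ⟨hp.1, mem_univ _⟩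
      have h5 : ContinuousOn (fun p : Y × ℝ => ρ p.1) (A ×ˢ Icc 0 1) :=
        (hρc.mono hAV).comp continuousOn_fst fun p hp => hp.1
      exact continuousOn_fst.prodMk (continuousOn_const.add
        (continuousOn_snd.mul (h5.sub continuousOn_const)))
  -- contracting the loops
  set e₂ : Y → ℝ → X := fun y τ => if hy : y ∈ A then
    F (projIcc 0 1 zero_le_one τ, (⟨y, hy⟩, projIcc 0 1 zero_le_one (ρ y))) else X.pt with he₂
  have hbd : ∀ (y : Y) (hy : y ∈ A) (τ : unitInterval) (t : unitInterval), t = 0 ∨ t = 1 →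
      F (τ, (⟨y, hy⟩, t)) = X.pt := fun y hy τ t ht => F.eq_snd τ (x := (⟨y, hy⟩, t)) ht
  have he₂1 : ∀ y ∈ V₁ ∪ V₂, ∀ τ, e₂ y τ = X.pt := by
    intro y hy τ
    simp only [he₂]
    split_ifs with hyA
    · refine hbd y hyA _ _ ?_
      rcases hy with hy | hy
      · left
        rw [hρ0 y hy, projIcc_left]
        rfl
      · right
        rw [hρ1 y hy, projIcc_right]
        rfl
    · rfl
  have he₂c : ContinuousOn (fun p : Y × ℝ => e₂ p.1 p.2) (V ×ˢ univ) := by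
    refine continuousOn_of_forall_continuousAt ?_
    rintro ⟨y, τ⟩ ⟨hy, -⟩
    have hV₁₂ : y ∈ V₁ ∪ V₂ → ContinuousAt (fun p : Y × ℝ => e₂ p.1 p.2) (y, τ) := by
      intro h3
      have h4 : (fun p : Y × ℝ => e₂ p.1 p.2) =ᶠ[𝓝 (y, τ)] fun _ => X.pt := by
        filter_upwards [((hV₁o.union hV₂o).prod isOpen_univ).mem_nhds
          (show (y, τ) ∈ (V₁ ∪ V₂) ×ˢ (univ : Set ℝ) from ⟨h3, mem_univ _⟩)] with p hp
        exact he₂1 p.1 hp.1 p.2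
      exact continuousAt_const.congr h4.symm
    rcases hcov y hy with h3 | h3 | h3
    · exact hV₁₂ (Or.inl h3)
    · exact hV₁₂ (Or.inr h3)
    · have h4 : Continuous fun p : A × ℝ =>
          F (projIcc 0 1 zero_le_one p.2, (p.1, projIcc 0 1 zero_le_one (ρ p.1))) := by
        have h5 : Continuous fun a : A => ρ a :=
          (hρc.mono hAV).comp_continuous continuous_subtype_val fun a => a.2
        refine F.continuous.comp ((continuous_projIcc.comp continuous_snd).prodMk
          (continuous_fst.prodMk (continuous_projIcc.comp (h5.comp continuous_fst))))
      exact (continuousOn_dite_subtype h4 X.pt).continuousAt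
        ((hAo.prod isOpen_univ).mem_nhds ⟨h3, mem_univ _⟩)
  -- the concatenation
  have hmatch : ∀ y ∈ V, f.toMap (e₁ y 1) = e₂ y 0 := by
    intro y hy
    have h3 : e₁ y 1 = q y (ρ y) := by
      simp only [he₁]
      congr 1
      ring
    rw [h3]
    by_cases hyA : y ∈ A
    · simp only [he₂, dif_pos hyA]
      rw [projIcc_left]
      have h4 := F.apply_zero (⟨y, hyA⟩, projIcc 0 1 zero_le_one (ρ y))
      refine Eq.trans ?_ h4.symm
      change f.toMap (q y (ρ y)) = f.toMap (q y _)
      rw [projIcc_of_mem _ (hρI y)]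
    · have h4 : y ∈ V₁ ∪ V₂ := by
        rcases hcov y hy with h | h | h
        · exact Or.inl h
        · exact Or.inr h
        · exact absurd h hyA
      rw [he₂1 y h4]
      have h5 : q y (ρ y) = X.pt := by
        rcases h4 with h | h
        · rw [hρ0 y h, hq1 y 0 (hu₁ y h) (by norm_num)]
          simpa using h₁1 y (hu₁ y h)
        · rw [hρ1 y h, hq2 y 1 (hv₂ y h) (by norm_num)]
          have : (2 : ℝ) * 1 - 1 = 1 := by norm_num
          rw [this]
          exact h₂1 y (hv₂ y h)
      rw [h5]
      exact f.map_pt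
  refine ⟨fun y τ => if τ ≤ 1 / 2 then f.toMap (e₁ y (max 0 (min 1 (2 * τ)))) else
    e₂ y (max 0 (2 * τ - 1)), ?_, fun y hy => ?_, fun y hy => ?_⟩
  · have hsw : ContinuousOn (fun p : Y × ℝ => f.toMap (e₁ p.1 (max 0 (min 1 (2 * p.2)))))
        (V ×ˢ univ) := by
      refine f.toMap.continuous.comp_continuousOn (he₁c.comp
        (f := fun p : Y × ℝ => (p.1, max 0 (min 1 (2 * p.2)))) (by fun_prop) fun p hp => ⟨hp.1, ?_⟩)
      exact ⟨le_max_left _ _, max_le zero_le_one (min_le_left _ _)⟩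
    have hse : ContinuousOn (fun p : Y × ℝ => e₂ p.1 (max 0 (2 * p.2 - 1))) (V ×ˢ univ) :=
      he₂c.comp (f := fun p : Y × ℝ => (p.1, max 0 (2 * p.2 - 1))) (by fun_prop)
        fun p hp => ⟨hp.1, mem_univ _⟩
    rw [continuousOn_iff_continuous_domRestrict] at hsw hse ⊢
    refine (Continuous.if_le hsw hse (f := fun p : (V ×ˢ (univ : Set ℝ) : Set (Y × ℝ)) => p.1.2)
      (g := fun _ => 1 / 2) (by fun_prop) continuous_const ?_)
    rintro ⟨⟨y, τ⟩, hy, hz⟩ hτ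
    obtain rfl : τ = 1 / 2 := hτ
    have h3 : max (0 : ℝ) (min 1 (2 * (1 / 2))) = 1 := by norm_num
    have h4 : max (0 : ℝ) (2 * (1 / 2) - 1) = 0 := by norm_num
    change f.toMap (e₁ y (max 0 (min 1 (2 * (1 / 2))))) = e₂ y (max 0 (2 * (1 / 2) - 1))
    rw [h3, h4]
    exact hmatch y hy
  · simp [he₁, ← hqG]
  · have h3 : ¬ (1 : ℝ) ≤ 1 / 2 := by norm_num
    have h4 : max (0 : ℝ) (2 * 1 - 1) = 1 := by norm_num
    simp only [if_neg h3, h4, he₂]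
    split_ifs with hyA
    · rw [projIcc_right]
      exact F.apply_one _
    · rfl

/-! ### From free to based null-homotopies -/

/-- In an open subset of a normed space, a null-homotopy can be made to respect the base point. -/
theorem NullOn.homotopicRel_const {H X : Type*} [NormedAddCommGroup H] [NormedSpace ℝ H]
    [TopologicalSpace X] {W : Set H} (hW : IsOpen W) (w₀ : W) {G : C(W, X)} {x₀ : X}
    (hG : G w₀ = x₀) (h : NullOn G x₀ univ) : G.HomotopicRel (ContinuousMap.const W x₀) {w₀} := by
  obtain ⟨h, hc, hh0, hh1⟩ := h
  rw [univ_prod_univ, continuousOn_univ] at hc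
  obtain ⟨δ, hδ, hball⟩ := Metric.isOpen_iff.1 hW w₀ w₀.2
  obtain ⟨ε, hε, rfl⟩ : ∃ ε : ℝ, 0 < ε ∧ 2 * ε = δ := ⟨δ / 2, by linarith, by ring⟩
  let d : W → ℝ := fun w => ‖(w : H) - w₀‖ / ε
  have hd : Continuous d := by fun_prop
  have hd0 : ∀ w, 0 ≤ d w := fun w => by positivity
  have hdw : d w₀ = 0 := by simp [d]
  let m : W → ℝ := fun w => max 0 (min 1 (d w - 1))
  have hm : Continuous m := by fun_prop
  have hm0 : ∀ w, 0 ≤ m w := fun w => le_max_left _ _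
  have hm1 : ∀ w, m w ≤ 1 := fun w => max_le zero_le_one (min_le_left _ _)
  -- A deformation of `W` that fixes `w₀`, shrinks the ball of radius `ε` to `w₀` and is stationary
  -- at distance at least `2 * ε`.
  let κ : C(unitInterval × W, W) :=
    ⟨fun p => ⟨w₀ + (1 - (p.1 : ℝ) * (1 - m p.2)) • ((p.2 : H) - w₀), by
      have ht0 := p.1.2.1
      have ht1 := p.1.2.2
      have hm0' := hm0 p.2
      have hm1' := hm1 p.2
      by_cases hw : d p.2 < 2
      · refine hball ?_
        rw [mem_ball_iff_norm, add_sub_cancel_left, norm_smul, Real.norm_eq_abs]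
        have h1 : ‖(p.2 : H) - w₀‖ < 2 * ε := (div_lt_iff₀ hε).1 hw
        have h2 : |1 - (p.1 : ℝ) * (1 - m p.2)| ≤ 1 := by
          rw [abs_le]
          constructor <;> nlinarith
        exact (mul_le_of_le_one_left (norm_nonneg _) h2).trans_lt h1
      · have h1 : m p.2 = 1 := by
          simp only [m]
          rw [min_eq_left (by linarith), max_eq_right zero_le_one]
        rw [h1, sub_self, mul_zero, sub_zero, one_smul, add_sub_cancel]
        exact p.2.2⟩, by fun_prop⟩
  have hκ0 : ∀ w, κ (0, w) = w := fun w => by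
    refine Subtype.ext ?_
    simp [κ]
  have hκw : ∀ t, κ (t, w₀) = w₀ := fun t => by
    refine Subtype.ext ?_
    simp [κ]
  have hκ1 : ∀ w, d w ≤ 1 → κ (1, w) = w₀ := fun w hw => by
    refine Subtype.ext ?_
    have h1 : m w = 0 := max_eq_left ((min_le_right _ _).trans (by linarith))
    simp [κ, h1]
  let l : W → ℝ := fun w => min 1 (d w)
  have hl : Continuous l := by fun_prop
  have hlw : l w₀ = 0 := by simp [l, hdw]
  -- Either `κ` has already moved `w` to `w₀`, or `l w = 1` and both sides are `x₀`.
  have hend : ∀ w, h (κ (1, w)) (l w) = h w₀ (l w) := fun w => by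
    rcases le_total (d w) 1 with hw | hw
    · rw [hκ1 w hw]
    · have h1 : l w = 1 := min_eq_left hw
      rw [h1, hh1 _ (mem_univ _), hh1 _ (mem_univ _)]
  have hw0 : h w₀ 0 = x₀ := (hh0 _ (mem_univ _)).trans hG
  let G₁ : C(W, X) := ⟨fun w => G (κ (1, w)), by fun_prop⟩
  let G₂ : C(W, X) := ⟨fun w => h w₀ (l w), hc.comp (by fun_prop : Continuous fun w => (w₀, l w))⟩
  have H1 : G.HomotopicRel G₁ {w₀} := by
    refine ⟨⟨⟨⟨fun p => G (κ p), by fun_prop⟩, fun w => ?_, fun w => rfl⟩, ?_⟩⟩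
    · exact congrArg G (hκ0 w)
    · rintro t w rfl
      exact congrArg G (hκw t)
  have H2 : G₁.HomotopicRel G₂ {w₀} := by
    refine ⟨⟨⟨⟨fun p => h (κ (1, p.2)) (p.1 * l p.2), hc.comp
      (by fun_prop : Continuous fun p : unitInterval × W => (κ (1, p.2), (p.1 : ℝ) * l p.2))⟩,
      fun w => ?_, fun w => ?_⟩, ?_⟩⟩
    · change h (κ (1, w)) (((0 : unitInterval) : ℝ) * l w) = G (κ (1, w))
      rw [Set.Icc.coe_zero, zero_mul, hh0 _ (mem_univ _)]
    · change h (κ (1, w)) (((1 : unitInterval) : ℝ) * l w) = h w₀ (l w)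
      rw [Set.Icc.coe_one, one_mul, hend]
    · rintro t w rfl
      change h (κ (1, w)) (t * l w) = G (κ (1, w))
      rw [hlw, mul_zero, hh0 _ (mem_univ _)]
  -- `G₂` factors through `l : W → [0,1]` and the loop `h w₀`. Shrinking the interval to `0`
  -- contracts it, with `w₀` fixed as `l w₀ = 0`; the loop itself need not be null-homotopic.
  have H3 : G₂.HomotopicRel (ContinuousMap.const W x₀) {w₀} := by
    refine ⟨⟨⟨⟨fun p => h w₀ ((1 - p.1) * l p.2), hc.comp
      (by fun_prop : Continuous fun p : unitInterval × W => (w₀, (1 - (p.1 : ℝ)) * l p.2))⟩,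
      fun w => ?_, fun w => ?_⟩, ?_⟩⟩
    · change h w₀ ((1 - ((0 : unitInterval) : ℝ)) * l w) = h w₀ (l w)
      rw [Set.Icc.coe_zero, sub_zero, one_mul]
    · change h w₀ ((1 - ((1 : unitInterval) : ℝ)) * l w) = x₀
      rw [Set.Icc.coe_one, sub_self, zero_mul, hw0]
    · rintro t w rfl
      change h w ((1 - t) * l w) = h w (l w)
      rw [hlw, mul_zero]
  exact (H1.trans H2).trans H3

/-! ### Covers pulled back to the dominating set, and the conclusion -/

namespace OpenDomination

variable {X : BasedSpace.{u}} {H : Type u} [NormedAddCommGroup H] [NormedSpace ℝ H] {W : Set H}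

/-- A based self-map that is null-homotopic after composition with the domination is
null-homotopic as a based map. -/
theorem mk_eq_zero (D : OpenDomination X W) {f : BasedSpace.Map X X}
    (h : NullOn (fun w => f.toMap (D.r w)) X.pt univ) : BasedSpace.HClass.mk f = 0 := by
  have h1 : (f.toMap.comp D.r).HomotopicRel (ContinuousMap.const W X.pt) {D.s X.pt} := by
    refine NullOn.homotopicRel_const D.isOpen (D.s X.pt) ?_ h
    exact (congrArg f.toMap D.r_s_pt).trans f.map_pt
  have h2 := h1.precomp D.s (T := {X.pt}) (by
    rintro x rfl
    rfl)
  exact Quotient.sound (((D.htpy.comp_continuousMap f.toMap).symm).trans h2)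

/-- Path components of `X` are open: they are preimages under `s` of unions of path components of
`W`, which is locally path-connected. Connectedness does the rest. -/
theorem joined_pt [ConnectedSpace X] (D : OpenDomination X W) (x : X) : Joined x X.pt := by
  have hj : ∀ x, Joined (D.r (D.s x)) x := fun x => by
    obtain ⟨F⟩ := D.htpy
    exact ⟨F.evalAt x⟩
  have : LocallyPathConnectedSpace W := D.isOpen.locallyPathConnectedSpace
  have key : ∀ w : W, ∀ᶠ w' in 𝓝 w, Joined (D.r w) (D.r w') := fun w => by
    have h1 : pathComponent w ∈ 𝓝 w := (IsOpen.pathComponent w).mem_nhds (mem_pathComponent_self w)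
    filter_upwards [h1] with w' hw'
    obtain ⟨γ⟩ := hw'
    exact ⟨γ.map D.r.continuous⟩
  have hopen : ∀ P : X → Prop, (∀ x y, Joined x y → P x → P y) → IsOpen {x | P x} := by
    intro P hP
    have h1 : IsOpen {w : W | P (D.r w)} := by
      rw [isOpen_iff_mem_nhds]
      intro w hw
      filter_upwards [key w] with w' hw'
      exact hP _ _ hw' hw
    have h2 : {x | P x} = D.s ⁻¹' {w : W | P (D.r w)} := by
      ext x
      exact ⟨hP _ _ (hj x).symm, hP _ _ (hj x)⟩
    rw [h2]
    exact h1.preimage D.s.continuous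
  have hcl : IsClopen {x | Joined x X.pt} :=
    ⟨⟨hopen (fun x => ¬ Joined x X.pt) fun x y hxy hx hy => hx (hxy.trans hy)⟩,
      hopen _ fun x y hxy hx => hxy.symm.trans hx⟩
  exact eq_univ_iff_forall.1 (hcl.eq_univ ⟨X.pt, Joined.refl _⟩) x

/-- The restriction of the domination to the preimage of a set contractible in `X`. -/
theorem nullOn_of_nullhomotopic [ConnectedSpace X] (D : OpenDomination X W) {U : Set X}
    (hU : (⟨Subtype.val, continuous_subtype_val⟩ : C(U, X)).Nullhomotopic) :
    NullOn D.r X.pt (D.r ⁻¹' U) := by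
  classical
  obtain ⟨y, ⟨F⟩⟩ := hU
  obtain ⟨γ⟩ := D.joined_pt y
  let K := F.trans (⟨⟨fun p : unitInterval × U => γ p.1, by fun_prop⟩, fun _ => γ.source,
    fun _ => γ.target⟩ : (ContinuousMap.const U y).Homotopy (ContinuousMap.const U X.pt))
  have hK : Continuous fun p : (D.r ⁻¹' U) × ℝ =>
      K (projIcc 0 1 zero_le_one p.2, ⟨D.r p.1, p.1.2⟩) := by
    have h1 : Continuous fun p : (D.r ⁻¹' U) × ℝ => (⟨D.r p.1, p.1.2⟩ : U) :=
      Continuous.subtype_mk (by fun_prop) _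
    have h2 : Continuous fun p : (D.r ⁻¹' U) × ℝ => projIcc (0 : ℝ) 1 zero_le_one p.2 :=
      continuous_projIcc.comp continuous_snd
    exact K.continuous.comp (h2.prodMk h1)
  refine ⟨fun w t => if h : w ∈ D.r ⁻¹' U then K (projIcc 0 1 zero_le_one t, ⟨D.r w, h⟩) else X.pt,
    continuousOn_dite_subtype hK X.pt, fun w hw => ?_, fun w hw => ?_⟩
  · simp only [dif_pos hw, projIcc_left]
    exact K.apply_zero _
  · simp only [dif_pos hw, projIcc_right]
    exact K.apply_one _

end OpenDomination

theorem exists_open_cover_of_lsCategory_eq {X : Type*} [TopologicalSpace X] {c : ℕ}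
    (hc : lsCategory X = c) : ∃ U : Fin c → Set X, (∀ i, IsOpen (U i)) ∧ (⋃ i, U i) = univ ∧
      ∀ i, (⟨Subtype.val, continuous_subtype_val⟩ : C(U i, X)).Nullhomotopic := by
  set S : Set ℕ∞ := {N : ℕ∞ | ∃ n : ℕ, N = n ∧ ∃ U : Fin n → Set X, (∀ i, IsOpen (U i)) ∧
    (⋃ i, U i) = univ ∧
    ∀ i, (⟨Subtype.val, continuous_subtype_val⟩ : C(U i, X)).Nullhomotopic} with hS
  have hne : S.Nonempty := by
    by_contra h
    rw [not_nonempty_iff_eq_empty] at h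
    have h1 : lsCategory X = sInf S := rfl
    rw [h, sInf_empty, hc] at h1
    exact ENat.natCast_ne_top c h1
  obtain ⟨n, hn, U, hU⟩ : lsCategory X ∈ S := csInf_mem hne
  obtain rfl : c = n := by exact_mod_cast hc.symm.trans hn
  exact ⟨U, hU⟩

namespace OpenDomination

variable {X : BasedSpace.{u}} {H : Type u} [NormedAddCommGroup H] [NormedSpace ℝ H] {W : Set H}

/-- A composite of `k` maps with `Σ`-trivial classes is null-homotopic on the union of `2 ^ k` sets
on which the domination is null-homotopic. -/
theorem nullOn_sum (D : OpenDomination X W) {ι : Type*} {ρ : ι → W → ℝ}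
    (hρ : ∀ i, Continuous (ρ i)) (hρ0 : ∀ i w, 0 ≤ ρ i w)
    (hnull : ∀ i, NullOn D.r X.pt {w | 0 < ρ i w}) (l : List (BasedSpace.HClass X X))
    (hl : ∀ f ∈ l, f ∈ BasedSpace.Z BasedSpace.suspensions X) :
    ∃ F : BasedSpace.Map X X, BasedSpace.HClass.mk F = l.prod ∧ ∀ S : Finset ι,
      S.card ≤ 2 ^ l.length →
        NullOn (fun w => F.toMap (D.r w)) X.pt {w | 0 < ∑ i ∈ S, ρ i w} := by
  classical
  have hempty : ∀ G : W → X, NullOn G X.pt {w | 0 < ∑ i ∈ (∅ : Finset ι), ρ i w} := fun G => by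
    refine ⟨fun _ _ => X.pt, continuousOn_const, fun w hw => ?_, fun w hw => ?_⟩ <;> simp at hw
  induction l with
  | nil =>
    refine ⟨BasedSpace.Map.id X, rfl, fun S hS => ?_⟩
    rw [List.length_nil, pow_zero] at hS
    rcases Nat.le_one_iff_eq_zero_or_eq_one.1 hS with h | h
    · obtain rfl := Finset.card_eq_zero.1 h
      exact hempty _
    · obtain ⟨i, rfl⟩ := Finset.card_eq_one.1 h
      simp only [Finset.sum_singleton]
      exact hnull i
  | cons f l ih =>
    obtain ⟨F, hF, hnF⟩ := ih fun g hg => hl g (List.mem_cons_of_mem _ hg)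
    obtain ⟨f, rfl⟩ : ∃ f', BasedSpace.HClass.mk f' = f := Quotient.exists_rep f
    refine ⟨f.comp F, ?_, fun S hS => ?_⟩
    · rw [List.prod_cons, ← hF]
      rfl
    -- Both halves have at most `2 ^ l.length` elements, so the inductive hypothesis applies to each
    -- with the same representative `F`.
    obtain ⟨S₁, hS₁, hc₁⟩ := Finset.exists_subset_card_eq (s := S) (n := S.card / 2) (by omega)
    have hc₂ := Finset.card_sdiff_add_card_eq_card hS₁
    rw [List.length_cons, pow_succ] at hS
    have h1 := NullOn.union D (hl _ List.mem_cons_self)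
      (u := fun w => ∑ i ∈ S \ S₁, ρ i w) (v := fun w => ∑ i ∈ S₁, ρ i w)
      (continuous_finsetSum _ fun i _ => hρ i) (continuous_finsetSum _ fun i _ => hρ i)
      (fun w => Finset.sum_nonneg fun i _ => hρ0 i w)
      (fun w => Finset.sum_nonneg fun i _ => hρ0 i w)
      (hnF (S \ S₁) (by omega)) (hnF S₁ (by omega))
    simp only [Finset.sum_sdiff hS₁] at h1
    exact h1

/-- A product of `n` classes that are `Σ`-trivial is trivial when `cat X ≤ 2 ^ n`. -/
theorem prod_eq_zero [ConnectedSpace X] (D : OpenDomination X W) {c : ℕ}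
    (hc : lsCategory X = c) (l : List (BasedSpace.HClass X X))
    (hl : ∀ f ∈ l, f ∈ BasedSpace.Z BasedSpace.suspensions X) (hcl : c ≤ 2 ^ l.length) :
    l.prod = 0 := by
  obtain ⟨U, hUo, hUc, hUn⟩ := exists_open_cover_of_lsCategory_eq hc
  obtain ⟨ρ, hρ⟩ := PartitionOfUnity.exists_isSubordinate_of_locallyFinite (isClosed_univ (X := W))
    (fun i => D.r ⁻¹' U i) (fun i => (hUo i).preimage D.r.continuous) (locallyFinite_of_finite _)
    (by rw [← preimage_iUnion, hUc, preimage_univ])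
  obtain ⟨F, hF, hn⟩ := D.nullOn_sum (ρ := fun i w => ρ i w) (fun i => (ρ i).continuous)
    (fun i w => ρ.nonneg i w) (fun i => by
      obtain ⟨h, h1, h2, h3⟩ := D.nullOn_of_nullhomotopic (hUn i)
      have h4 : {w | 0 < ρ i w} ⊆ D.r ⁻¹' U i := fun w hw =>
        hρ i (subset_tsupport _ (ne_of_gt hw))
      exact ⟨h, h1.mono (prod_mono h4 subset_rfl), fun y hy => h2 y (h4 hy),
        fun y hy => h3 y (h4 hy)⟩) l hl
  rw [← hF]
  refine D.mk_eq_zero ?_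
  have h1 := hn Finset.univ (by simpa using hcl)
  have h2 : {w : W | 0 < ∑ i, ρ i w} = univ := by
    refine eq_univ_of_forall fun w => ?_
    have h3 := ρ.sum_eq_one (mem_univ w)
    rw [finsum_eq_sum_of_fintype] at h3
    change 0 < ∑ i, ρ i w
    rw [h3]
    exact one_pos
  rwa [h2] at h1

end OpenDomination

theorem BasedSpace.coe_foldl_mul (F : Set BasedSpace.{u}) (X : BasedSpace.{u}) (x : Z F X)
    (l : List (Z F X)) :
    ((l.foldl (· * ·) x : Z F X) : HClass X X) = (x.1 :: l.map Subtype.val).prod := by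
  induction l generalizing x with
  | nil => simp
  | cons y l ih =>
    rw [List.foldl_cons, ih]
    simp only [List.map_cons, List.prod_cons, ← mul_assoc]
    rfl

theorem BasedSpace.contractibleSpace_of_one_eq_zero {X : BasedSpace.{u}}
    (h : (1 : HClass X X) = 0) : ContractibleSpace X := by
  rw [contractible_iff_id_nullhomotopic]
  obtain ⟨F⟩ : (Map.id X).Homotopic (Map.zero X X) := Quotient.exact h
  exact ⟨X.pt, ⟨F.toHomotopy⟩⟩

theorem proposition2p5 (X : BasedSpace.{u}) (hX : X.HasCWType) (hconn : ConnectedSpace X)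
    (c : ℕ) (hc : lsCategory X = c) :
    (∀ n : ℕ, Real.logb 2 c ≤ n →
      ∀ f : Fin n → BasedSpace.HClass X X,
        (∀ i, f i ∈ BasedSpace.Z BasedSpace.suspensions X) → (List.ofFn f).prod = 0) ∧
    BasedSpace.nilpotencyMod BasedSpace.suspensions X ≤ (⌈Real.logb 2 c⌉₊ : ℕ∞) := by
  obtain ⟨H, _, _, W, ⟨D⟩⟩ := hX.exists_openDomination
  have hpow : ∀ n : ℕ, Real.logb 2 c ≤ n → c ≤ 2 ^ n := fun n hn => by
    rcases Nat.eq_zero_or_pos c with rfl | hpos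
    · exact Nat.zero_le _
    · have h1 := (Real.logb_le_iff_le_rpow one_lt_two (by exact_mod_cast hpos)).1 hn
      rw [Real.rpow_natCast] at h1
      exact_mod_cast h1
  refine ⟨fun n hn f hf => D.prod_eq_zero hc _ ?_ ?_, ?_⟩
  · intro g hg
    obtain ⟨i, rfl⟩ := (List.mem_ofFn' _ _).1 hg
    exact hf i
  · rw [List.length_ofFn]
    exact hpow n hn
  · have hle := hpow _ (Nat.le_ceil (Real.logb 2 c))
    generalize ⌈Real.logb 2 c⌉₊ = n at hle
    unfold BasedSpace.nilpotencyMod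
    split_ifs with hcon
    · exact zero_le
    -- For `n = 0` the empty product, the identity class, would be trivial, against the assumption
    -- that `X` is not contractible. The semigroup nilpotency is thus only needed for `n ≥ 1`, as
    -- its definition requires.
    rcases Nat.eq_zero_or_pos n with rfl | hn
    · exact absurd (BasedSpace.contractibleSpace_of_one_eq_zero
        (D.prod_eq_zero hc [] (by simp) hle)) hcon
    · refine sInf_le ⟨n, hn, rfl, fun x l hxl => Subtype.ext ?_⟩
      rw [BasedSpace.coe_foldl_mul]
      refine D.prod_eq_zero hc _ ?_ (by simpa [hxl] using hle)
      intro f hf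
      rcases List.mem_cons.1 hf with rfl | hf
      · exact x.2
      · obtain ⟨z, -, rfl⟩ := List.mem_map.1 hf
        exact z.2
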